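/- **Setting.** Let $n\ge 1$, let $G=([T],\mathcal E)$ be an undirected graph with incidence matrix $D\in\{0,\pm1\}^{|\mathcal E|\times T}$ (for any orientation of the edges), and let $M=D\otimes I_n$. Let $x=(x_1,\dots,x_T)\in\mathbb R^{nT}$ be a fixed vector with $\|Mx\|_2^2=\sum_{\{t,t'\}\in\mathcal E}\|x_t-x_{t'}\|_2^2\le S_T$, where $S_T>0$. Let $\theta\in(0,1]$ and $\sigma\ge 0$. Let $C_1,\dots,C_T\in\mathbb R^{1\times n}$ be i.i.d., where $C_t=0$ with probability $1-\theta$ and, with probability $\theta$, $C_t$ is uniformly distributed on $\{e_1^\top,\dots,e_n^\top\}$. Let $C\in\mathbb R^{T\times nT}$ be the block-diagonal matrix with diagonal blocks $C_1,\dots,C_T$. We observe $y=Cx+\eta\in\mathbb R^T$, where the random noise vector $\eta\in\mathbb R^T$ is independent of $(C_t)_t$ and $\sigma$-subgaussian, that is, $\mathbb E\,e^{s\,u^\top\eta}\le e^{s^2\sigma^2/2}$ for all $s\in\mathbb R$ and all unit vectors $u$. For $\mu>0$ let $$\widehat x\in\operatorname*{argmin}_{z\in\mathbb R^{nT}}\Big\{\tfrac12\|y-Cz\|_2^2+\tfrac{\mu}{2}\|Mz\|_2^2\Big\}.$$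 **Error bounds.** Let $\delta\in(0,e^{-1})$ and $T\ge\frac{8n}{\theta}\log\frac n\delta$. 1. If $G$ is the complete graph, there are universal constants $c_1,c_2>0$ such that for $$\mu=\mu^*=\max\Big\{\sigma^{2/3}\Big(\frac{\theta}{T S_T}\Big)^{1/3}-\frac{\theta}{Tn},\ \frac{c_1}{T}\Big\}$$ it holds with probability at least $1-3\delta$ that $$\|\widehat x-x\|_2^2\le c_2\Big(\frac{nS_T}{\theta T}+\Big[\frac{n\sigma^{2/3}S_T^{2/3}}{\theta^{2/3}T^{1/3}}+\frac{n^3\sigma^2}{\theta^2}\Big]\log\frac1\delta\Big).$$ 2. If $G$ is a star graph (one central node joined to all the other nodes), there are universal constants $c_1,c_2>0$ such that for $$\mu=\mu^*=\max\Big\{\sigma^{2/3}\frac{\theta^{1/3}T^{1/3}}{S_T^{1/3}}-\frac{\theta}{n},\ c_1\Big\}$$ it holds with probability at least $1-3\delta$ that $$\|\widehat x-x\|_2^2\le c_2\Big(\frac{nS_T}{\theta}+\Big[\frac{n\sigma^{2/3}T^{1/3}S_T^{2/3}}{\theta^{2/3}}+\frac{n^3\sigma^2}{\theta^2}\Big]\log\frac1\delta\Big).$$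 On these events a minimizer $\widehat x$ exists, and the bound holds for every minimizer. **Weak consistency.** Fix $n$ and $\sigma$, let $T\to\infty$, and allow $\theta=\theta_T$, $S_T$, $x$ and the random model to vary with $T$. With the above choices of $\mu$, with the same $c_1$, the mean squared error $\frac1T\|\widehat x-x\|_2^2$ tends to $0$ in probability provided that 1. (complete graph) $S_T=o(T^2)$ and $\theta_T=\omega\big(\max\{1/\sqrt T,\ S_T/T^2\}\big)$; 2. (star graph) $S_T=o(T)$ and $\theta_T=\omega\big(\max\{1/\sqrt T,\ S_T/T\}\big)$. -/

import Mathlib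

open MeasureTheory ProbabilityTheory Filter Topology
open scoped Kronecker NNReal ENNReal

universe u

namespace GraphLS

/-- The incidence matrix `D` of `G`: the row of an edge has the entry `+1` at one endpoint and `-1`
at the other one (the edge is oriented from its smaller to its larger endpoint). -/
noncomputable def incidence {T : ℕ} (G : SimpleGraph (Fin T)) : Matrix G.edgeSet (Fin T) ℝ :=
  fun e t => if t = e.1.sup then 1 else if t = e.1.inf then -1 else 0

/-- `M = D ⊗ Iₙ`. -/
noncomputable def smoothMatrix {T : ℕ} (G : SimpleGraph (Fin T)) (n : ℕ) :
    Matrix (G.edgeSet × Fin n) (Fin T × Fin n) ℝ :=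
  incidence G ⊗ₖ (1 : Matrix (Fin n) (Fin n) ℝ)

open scoped Classical in
/-- The quadratic variation `‖M z‖₂²` of the stacked node signals `z = (z₁, …, z_T)`. -/
noncomputable def roughness {T n : ℕ} (G : SimpleGraph (Fin T))
    (z : EuclideanSpace ℝ (Fin T × Fin n)) : ℝ :=
  ‖Matrix.toEuclideanLin (smoothMatrix G n) z‖ ^ 2

/-- The block diagonal matrix `C` whose diagonal blocks are the `1 × n` rows `C₁, …, C_T`. -/
def measMatrix {T n : ℕ} (C : Fin T → Fin n → ℝ) : Matrix (Fin T) (Fin T × Fin n) ℝ :=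
  fun t p => if p.1 = t then C t p.2 else 0

/-- The observations `y = C x + η`, that is `y_t = C_t x_t + η_t`. -/
noncomputable def observe {T n : ℕ} (C : Fin T → Fin n → ℝ)
    (x : EuclideanSpace ℝ (Fin T × Fin n)) (η : EuclideanSpace ℝ (Fin T)) :
    EuclideanSpace ℝ (Fin T) :=
  Matrix.toEuclideanLin (measMatrix C) x + η

/-- The penalized least squares objective `½ ‖y - C z‖₂² + (μ / 2) ‖M z‖₂²`. -/
noncomputable def objective {T n : ℕ} (G : SimpleGraph (Fin T)) (μ : ℝ) (C : Fin T → Fin n → ℝ)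
    (y : EuclideanSpace ℝ (Fin T)) (z : EuclideanSpace ℝ (Fin T × Fin n)) : ℝ :=
  1 / 2 * ‖y - Matrix.toEuclideanLin (measMatrix C) z‖ ^ 2 + μ / 2 * roughness G z

/-- `xhat` is a penalized least squares estimate: a global minimizer of the objective. -/
def IsEstimate {T n : ℕ} (G : SimpleGraph (Fin T)) (μ : ℝ) (C : Fin T → Fin n → ℝ)
    (y : EuclideanSpace ℝ (Fin T)) (xhat : EuclideanSpace ℝ (Fin T × Fin n)) : Prop :=
  ∀ z, objective G μ C y xhat ≤ objective G μ C y z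

/-- The law of a sparse random row: zero with probability `1 - θ`, and with probability `θ` a
uniformly chosen canonical basis vector. -/
noncomputable def sparseRowLaw (n : ℕ) (θ : ℝ) : Measure (Fin n → ℝ) :=
  ENNReal.ofReal (1 - θ) • Measure.dirac 0 +
    ENNReal.ofReal θ •
      ((n : ℝ≥0∞)⁻¹ • ∑ i : Fin n, Measure.dirac (Pi.single i (1 : ℝ) : Fin n → ℝ))

/-- A random vector is `σ`-subgaussian if `E exp (t ⟨u, Y⟩) ≤ exp (t² σ² / 2)` for all real `t` and
all unit vectors `u`. -/
def IsSubgaussianVector {Ω : Type*} [MeasurableSpace Ω] (P : Measure Ω) {m : ℕ} (σ : ℝ)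
    (Y : Ω → EuclideanSpace ℝ (Fin m)) : Prop :=
  ∀ u : EuclideanSpace ℝ (Fin m), ‖u‖ = 1 →
    HasSubgaussianMGF (fun ω => inner ℝ u (Y ω)) (Real.toNNReal (σ ^ 2)) P

/-- The random inputs: i.i.d. sparse rows `C₁, …, C_T`, and a `σ`-subgaussian noise vector `η` that
is independent of the rows. -/
structure SparseModel {Ω : Type*} [MeasurableSpace Ω] (P : Measure Ω) {T n : ℕ} (θ σ : ℝ)
    (C : Fin T → Ω → Fin n → ℝ) (η : Ω → EuclideanSpace ℝ (Fin T)) : Prop where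
  measurable_row : ∀ t, Measurable (C t)
  law_row : ∀ t, P.map (C t) = sparseRowLaw n θ
  indep_rows : iIndepFun C P
  measurable_noise : Measurable η
  subgaussian_noise : IsSubgaussianVector P σ η
  indep_noise : IndepFun (fun ω t => C t ω) η P

/-- The choice `μ*` for the complete graph. -/
noncomputable def muComplete (c₁ : ℝ) (n T : ℕ) (θ σ S : ℝ) : ℝ :=
  max (σ ^ (2 / 3 : ℝ) * (θ / (T * S)) ^ (1 / 3 : ℝ) - θ / (T * n)) (c₁ / T)

/-- The choice `μ*` for the star graph. -/
noncomputable def muStar (c₁ : ℝ) (n T : ℕ) (θ σ S : ℝ) : ℝ :=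
  max (σ ^ (2 / 3 : ℝ) * θ ^ (1 / 3 : ℝ) * (T : ℝ) ^ (1 / 3 : ℝ) / S ^ (1 / 3 : ℝ) - θ / n) c₁

end GraphLS

/-! A row of `C` reads at most one coordinate and the penalty is `D ⊗ I`, so least squares decouples
into `n` scalar problems, one per coordinate, each observed on a random node set `N`. In one problem
let `κ` be the mean noise on `N` and let `g` be the error minus `κ`. Testing the normal equation
with constants kills the penalty and gives `∑_N g = 0`; testing with `g` gives an energy identity.
Only constants escape the penalty, and the spectral gap `lam` (at least `T` for the complete graph,
`1` for the star) controls the rest. The zero sum on `N` bounds the global mean of `g` by its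
variance, at the price of a factor `T / |N|`, which is of order `n / θ`. This is `coordinate_bound`,
resting on `energy_bound`.

Randomness enters through three quantities. Chernoff bounds keep every `|N|` above half its mean and
limit the total number of observations. For a fixed row pattern, independence leaves the noise
subgaussian, and a squared exponential moment with Jensen's inequality bounds both the observed
noise energy and the normalized noise sums, using one-dimensional marginals only
(`IsSubgaussianVector.measure_sum_sq_gt_le`).

The noise energy is damped by `(1 + μ * lam) ^ 2`, and `μ*` is large enough for `noise_term_le` to
turn this into the stated rate. Both graphs are instances of `SparseModel.exists_errorBound_event`
with `s = S / lam`. Consistency follows because the bound divided by `T` is a function of `s / (T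
θ)` and `1 / (√T θ)` that vanishes with them, for every fixed `δ`. -/

namespace GraphLS

/-! ### Penalized least squares in finite dimension -/

section LeastSquares

variable {V W W' : Type*} [NormedAddCommGroup V] [InnerProductSpace ℝ V]
  [NormedAddCommGroup W] [InnerProductSpace ℝ W] [NormedAddCommGroup W'] [InnerProductSpace ℝ W']

/-- The first order condition at a minimizer of a penalized least squares objective. -/
theorem inner_add_inner_eq_zero_of_forall_le (A : V →ₗ[ℝ] W) (B : V →ₗ[ℝ] W') {μ : ℝ} {y : W} {z : V}
    (h : ∀ z', 1 / 2 * ‖y - A z‖ ^ 2 + μ / 2 * ‖B z‖ ^ 2 ≤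
      1 / 2 * ‖y - A z'‖ ^ 2 + μ / 2 * ‖B z'‖ ^ 2) (d : V) :
    inner ℝ (A z - y) (A d) + μ * inner ℝ (B z) (B d) = 0 := by
  set p := inner ℝ (A z - y) (A d) + μ * inner ℝ (B z) (B d) with hp
  set q := (‖A d‖ ^ 2 + μ * ‖B d‖ ^ 2) / 2 with hq
  have key : ∀ s : ℝ, 0 ≤ s * p + s ^ 2 * q := by
    intro s
    have h1 := h (z + s • d)
    have h2 : ‖y - A (z + s • d)‖ ^ 2 =
        ‖y - A z‖ ^ 2 + 2 * s * inner ℝ (A z - y) (A d) + s ^ 2 * ‖A d‖ ^ 2 := by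
      have : y - A (z + s • d) = (y - A z) - s • A d := by
        rw [map_add, map_smul]; abel
      rw [this, norm_sub_sq_real, norm_smul, mul_pow, inner_smul_right, Real.norm_eq_abs, sq_abs,
        ← neg_sub (A z) y, inner_neg_left, norm_neg]
      ring
    have h3 : ‖B (z + s • d)‖ ^ 2 =
        ‖B z‖ ^ 2 + 2 * s * inner ℝ (B z) (B d) + s ^ 2 * ‖B d‖ ^ 2 := by
      rw [map_add, map_smul, norm_add_sq_real, norm_smul, mul_pow, inner_smul_right,
        Real.norm_eq_abs, sq_abs]
      ring
    rw [h2, h3] at h1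
    rw [hp, hq]
    nlinarith
  by_contra hne
  have hq0 : 0 < |q| + 1 := by positivity
  -- A step against `p`, short enough for the linear term to win; `|q| + 1` is positive whatever the
  -- sign of `q`.
  have h1 := key (-p / (|q| + 1))
  have h2 : -p / (|q| + 1) * p + (-p / (|q| + 1)) ^ 2 * q =
      -(p ^ 2 / (|q| + 1) ^ 2) * (|q| + 1 - q) := by
    field_simp
    ring
  rw [h2] at h1
  have h3 : 0 < p ^ 2 / (|q| + 1) ^ 2 := by positivity
  have h4 : 0 < |q| + 1 - q := by linarith [le_abs_self q]
  nlinarith [mul_pos h3 h4]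

/-- A penalized least squares objective on a finite-dimensional space has a minimizer. -/
theorem exists_forall_penalized_le [FiniteDimensional ℝ V] (A : V →ₗ[ℝ] W) (B : V →ₗ[ℝ] W') {μ : ℝ}
    (hμ : 0 ≤ μ) (y : W) :
    ∃ z, ∀ z', 1 / 2 * ‖y - A z‖ ^ 2 + μ / 2 * ‖B z‖ ^ 2 ≤
      1 / 2 * ‖y - A z'‖ ^ 2 + μ / 2 * ‖B z'‖ ^ 2 := by
  -- Stacking `A` and `√μ • B` makes the objective half the squared distance from `(y, 0)` to a
  -- finite-dimensional subspace, where a nearest point exists.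
  let F : V →ₗ[ℝ] WithLp 2 (W × W') :=
    (WithLp.linearEquiv 2 ℝ (W × W')).symm.toLinearMap ∘ₗ (A.prod (√μ • B))
  let b : WithLp 2 (W × W') := WithLp.toLp 2 (y, 0)
  have hF : ∀ z, 1 / 2 * ‖y - A z‖ ^ 2 + μ / 2 * ‖B z‖ ^ 2 = 1 / 2 * ‖b - F z‖ ^ 2 := by
    intro z
    have h2 : ‖b - F z‖ ^ 2 = ‖y - A z‖ ^ 2 + ‖(0 : W') - √μ • B z‖ ^ 2 :=
      WithLp.prod_norm_sq_eq_of_L2 _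
    rw [h2, zero_sub, norm_neg, norm_smul, mul_pow, Real.norm_eq_abs, sq_abs, Real.sq_sqrt hμ]
    ring
  obtain ⟨_, ⟨z, rfl⟩, hz⟩ := (LinearMap.range F).exists_norm_eq_iInf_of_complete_subspace
    (Submodule.complete_of_finiteDimensional _) b
  refine ⟨z, fun z' => ?_⟩
  rw [hF, hF]
  have : ‖b - F z‖ ≤ ‖b - F z'‖ := by
    rw [hz]
    exact ciInf_le ⟨0, by rintro _ ⟨w, rfl⟩; exact norm_nonneg _⟩
      (⟨F z', LinearMap.mem_range_self F z'⟩ : LinearMap.range F)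
  gcongr

end LeastSquares

/-! ### The Dirichlet form of a graph -/

section Dirichlet

open scoped Classical in
/-- The Dirichlet form `⟨D f, D g⟩` of a graph. -/
noncomputable def dirichlet {T : ℕ} (G : SimpleGraph (Fin T)) (f g : Fin T → ℝ) : ℝ :=
  ∑ e : G.edgeSet, (incidence G).mulVec f e * (incidence G).mulVec g e

variable {T n : ℕ} {G : SimpleGraph (Fin T)}

theorem incidence_mulVec (f : Fin T → ℝ) (e : G.edgeSet) :
    (incidence G).mulVec f e = f e.1.sup - f e.1.inf := by
  have hne : e.1.inf ≠ e.1.sup := by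
    have := G.not_isDiag_of_mem_edgeSet e.2
    rcases e with ⟨e, he⟩
    induction e with
    | _ a b =>
      simp only [Sym2.inf_mk, Sym2.sup_mk]
      simp only [Sym2.mk_isDiag_iff] at this
      intro h
      exact this (inf_eq_sup.mp h)
  simp only [Matrix.mulVec, dotProduct, incidence]
  have : ∀ t, (if t = e.1.sup then (1 : ℝ) else if t = e.1.inf then -1 else 0) * f t =
      (if t = e.1.sup then f t else 0) - (if t = e.1.inf then f t else 0) := by
    intro t
    by_cases h1 : t = e.1.sup
    · subst h1; simp [hne.symm]
    · by_cases h2 : t = e.1.inf <;> simp [h1, h2, hne]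
  simp [this, Finset.sum_sub_distrib]

theorem dirichlet_self_nonneg (f : Fin T → ℝ) : 0 ≤ dirichlet G f f :=
  Finset.sum_nonneg fun _ _ => mul_self_nonneg _

theorem dirichlet_sub_const_left (f g : Fin T → ℝ) (c : ℝ) :
    dirichlet G (fun t => f t - c) g = dirichlet G f g := by
  simp [dirichlet, incidence_mulVec]

theorem dirichlet_const_right (f : Fin T → ℝ) (c : ℝ) : dirichlet G f (fun _ => c) = 0 := by
  simp [dirichlet, incidence_mulVec]

theorem dirichlet_sub_left (f f' g : Fin T → ℝ) :
    dirichlet G (fun t => f t - f' t) g = dirichlet G f g - dirichlet G f' g := by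
  simp only [dirichlet, incidence_mulVec, ← Finset.sum_sub_distrib]
  exact Finset.sum_congr rfl fun _ _ => by ring

theorem sq_dirichlet_le (f g : Fin T → ℝ) :
    dirichlet G f g ^ 2 ≤ dirichlet G f f * dirichlet G g g := by
  simp only [dirichlet, ← pow_two]
  exact Finset.sum_mul_sq_le_sq_mul_sq _ _ _

/-- The Dirichlet energy as a sum over ordered pairs of nodes. -/
theorem two_mul_dirichlet_self [inst : DecidableRel G.Adj] (f : Fin T → ℝ) :
    2 * dirichlet G f f = ∑ u, ∑ v, if G.Adj u v then (f u - f v) ^ 2 else 0 := by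
  obtain rfl : inst = fun a b => Classical.propDecidable (G.Adj a b) := Subsingleton.elim _ _
  classical
  let F : Sym2 (Fin T) → ℝ := fun e => (f e.sup - f e.inf) ^ 2
  have hF : ∀ u v, F s(u, v) = (f u - f v) ^ 2 := by
    intro u v
    simp only [F, Sym2.sup_mk, Sym2.inf_mk]
    rcases le_total u v with h | h
    · rw [sup_eq_right.mpr h, inf_eq_left.mpr h]; ring
    · rw [sup_eq_left.mpr h, inf_eq_right.mpr h]
  have h1 : dirichlet G f f = ∑ e ∈ G.edgeFinset, F e := by
    rw [Finset.sum_subtype (F := G.fintypeEdgeSet) G.edgeFinset (p := (· ∈ G.edgeSet)) (by simp)]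
    simp only [dirichlet, incidence_mulVec, F, pow_two]
  -- Every edge underlies exactly two darts, which is the source of the factor 2.
  have h2 : (∑ d : G.Dart, F d.edge) = 2 * ∑ e ∈ G.edgeFinset, F e := by
    have hmaps : ∀ d ∈ (Finset.univ : Finset G.Dart), d.edge ∈ G.edgeFinset := fun d _ => by simp
    rw [← Finset.sum_fiberwise_of_maps_to hmaps, Finset.mul_sum]
    refine Finset.sum_congr rfl fun e he => ?_
    rw [Finset.sum_congr rfl (g := fun _ => F e) (fun d hd => by rw [(Finset.mem_filter.mp hd).2]),
      Finset.sum_const, G.dart_edge_fiber_card e (by simpa using he)]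
    simp
  have h3 : (∑ d : G.Dart, F d.edge) =
      ∑ p ∈ (Finset.univ : Finset (Fin T × Fin T)).filter (fun p => G.Adj p.1 p.2),
        (f p.1 - f p.2) ^ 2 := by
    refine Finset.sum_bij' (fun d _ => (d.fst, d.snd))
      (fun p hp => ⟨p, (Finset.mem_filter.1 hp).2⟩) ?_ ?_ ?_ ?_ ?_
    · intro d _; simp [d.adj]
    · intro d _; simp
    · intro d _; rfl
    · intro d _; rfl
    · intro d _; exact hF _ _
  rw [h1, ← h2, h3, Finset.sum_filter, Fintype.sum_prod_type]

/-- The bias-variance identity: deviations from the mean are orthogonal to constants. Both spectral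
gaps and the passage from variance to full norm use it. -/
theorem sum_sub_sq_eq (f : Fin T → ℝ) (hT : T ≠ 0) (c : ℝ) :
    ∑ t, (f t - c) ^ 2 = ∑ t, (f t - (∑ s, f s) / T) ^ 2 + T * ((∑ s, f s) / T - c) ^ 2 := by
  have hT' : (T : ℝ) ≠ 0 := by exact_mod_cast hT
  set b := (∑ s, f s) / T with hb
  have hs : ∑ s, f s = T * b := by rw [hb]; field_simp
  have h1 : ∀ t, (f t - c) ^ 2 = (f t - b) ^ 2 + 2 * (b - c) * f t - (b ^ 2 - c ^ 2) * 1 -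
     (2 * (b - c) * b - (b - c) ^ 2 - (b ^ 2 - c ^ 2)) * 1 := by
    intro t; ring
  simp_rw [h1]
  rw [Finset.sum_sub_distrib, Finset.sum_sub_distrib, Finset.sum_add_distrib, ← Finset.mul_sum,
    ← Finset.mul_sum, ← Finset.mul_sum, hs]
  simp
  ring

/-- The spectral gap of the complete graph. -/
theorem gap_complete (hT : T ≠ 0) (f : Fin T → ℝ) :
    (T : ℝ) * ∑ t, (f t - (∑ s, f s) / T) ^ 2 ≤ dirichlet (⊤ : SimpleGraph (Fin T)) f f := by
  classical
  have h := two_mul_dirichlet_self (G := ⊤) f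
  have h1 : ∀ u v, (if (⊤ : SimpleGraph (Fin T)).Adj u v then (f u - f v) ^ 2 else 0) =
      (f u - f v) ^ 2 := by
    intro u v
    by_cases huv : u = v <;> simp [huv]
  simp only [h1] at h
  have h2 : ∀ u, ∑ v, (f u - f v) ^ 2 = ∑ v, (f v - f u) ^ 2 := fun u =>
    Finset.sum_congr rfl fun v _ => by ring
  -- The identity is taken about each value `f u`; summing over `u` then yields `T` times the
  -- variance sum twice.
  have h3 : ∀ u, ∑ v, (f u - f v) ^ 2 =
      ∑ t, (f t - (∑ s, f s) / T) ^ 2 + T * (f u - (∑ s, f s) / T) ^ 2 := fun u => by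
    rw [h2, sum_sub_sq_eq f hT, sub_sq_comm (f u)]
  rw [Finset.sum_congr rfl fun u _ => h3 u, Finset.sum_add_distrib, ← Finset.mul_sum] at h
  simp only [Finset.sum_const, Finset.card_univ, Fintype.card_fin, nsmul_eq_mul] at h
  linarith

/-- The spectral gap of the star graph. -/
theorem gap_star (hT : T ≠ 0) (r : Fin T) (f : Fin T → ℝ) :
    (1 : ℝ) * ∑ t, (f t - (∑ s, f s) / T) ^ 2 ≤ dirichlet (SimpleGraph.starGraph r) f f := by
  classical
  have h := two_mul_dirichlet_self (G := SimpleGraph.starGraph r) f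
  have h1 : ∀ u v, (if u = r then (f v - f r) ^ 2 else 0) + (if v = r then (f u - f r) ^ 2 else 0) ≤
      (if (SimpleGraph.starGraph r).Adj u v then (f u - f v) ^ 2 else 0) := by
    intro u v
    by_cases hu : u = r <;> by_cases hv : v = r
    · simp [hu, hv]
    · simp only [hu, hv, SimpleGraph.starGraph_adj]
      simp [Ne.symm hv, sub_sq_comm]
    · simp [hu, hv]
    · simp [hu, hv]
  have h2 := Finset.sum_le_sum fun u (_ : u ∈ Finset.univ) =>
    Finset.sum_le_sum fun v (_ : v ∈ Finset.univ) => h1 u v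
  replace h2 := h2.trans_eq h.symm
  simp only [Finset.sum_add_distrib, Finset.sum_ite_eq', Finset.mem_univ, if_true] at h2
  rw [Finset.sum_comm] at h2
  simp only [Finset.sum_ite_eq', Finset.mem_univ, if_true] at h2
  -- The energy dominates the squared deviations from the central value, and these dominate the
  -- deviations from the mean.
  have h3 := sum_sub_sq_eq f hT (f r)
  have h4 : 0 ≤ (T : ℝ) * ((∑ s, f s) / T - f r) ^ 2 := by positivity
  linarith

open scoped Classical in
theorem smoothMatrix_apply (z : EuclideanSpace ℝ (Fin T × Fin n)) (e : G.edgeSet) (i : Fin n) :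
    Matrix.toEuclideanLin (smoothMatrix G n) z (e, i) =
      (incidence G).mulVec (fun t => z (t, i)) e := by
  simp only [Matrix.toLpLin_apply, Matrix.mulVec, dotProduct, smoothMatrix,
    Matrix.kroneckerMap_apply, Fintype.sum_prod_type, Matrix.one_apply]
  simp

open scoped Classical in
-- The identity factor of the Kronecker product never mixes coordinates; this is the penalty's half
-- of the decoupling.
theorem inner_smoothMatrix (z d : EuclideanSpace ℝ (Fin T × Fin n)) :
    inner ℝ (Matrix.toEuclideanLin (smoothMatrix G n) z) (Matrix.toEuclideanLin (smoothMatrix G n) d)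
      = ∑ i, dirichlet G (fun t => z (t, i)) (fun t => d (t, i)) := by
  simp only [PiLp.inner_apply, Fintype.sum_prod_type, smoothMatrix_apply, dirichlet]
  rw [Finset.sum_comm]
  refine Finset.sum_congr rfl fun i _ => Finset.sum_congr rfl fun e _ => ?_
  simp [mul_comm]

open scoped Classical in
theorem roughness_eq (z : EuclideanSpace ℝ (Fin T × Fin n)) :
    roughness G z = ∑ i, dirichlet G (fun t => z (t, i)) (fun t => z (t, i)) := by
  rw [roughness, ← inner_smoothMatrix, real_inner_self_eq_norm_sq]

end Dirichlet

/-! ### Deterministic error bound -/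

section Deterministic

variable {T n : ℕ} {G : SimpleGraph (Fin T)}

/-- The row `eᵢ` for `some i` and the zero row for `none`. -/
def rowVec (o : Option (Fin n)) : Fin n → ℝ := fun i => if o = some i then 1 else 0

/-- The nodes at which the coordinate `i` is observed. -/
def obs (o : Fin T → Option (Fin n)) (i : Fin n) : Finset (Fin T) :=
  Finset.univ.filter fun t => o t = some i

theorem measMatrix_apply (o : Fin T → Option (Fin n)) (z : EuclideanSpace ℝ (Fin T × Fin n))
    (t : Fin T) :
    Matrix.toEuclideanLin (measMatrix fun t => rowVec (o t)) z t =
      ∑ i, if o t = some i then z (t, i) else 0 := by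
  simp only [Matrix.toLpLin_apply, Matrix.mulVec, dotProduct, measMatrix, rowVec,
    Fintype.sum_prod_type]
  rw [Finset.sum_eq_single t]
  · simp
  · intro s _ hs; simp [hs]
  · simp

theorem exists_isEstimate {μ : ℝ} (hμ : 0 ≤ μ) (C : Fin T → Fin n → ℝ)
    (y : EuclideanSpace ℝ (Fin T)) : ∃ z, IsEstimate G μ C y z := by
  classical
  exact exists_forall_penalized_le _ _ hμ y

/-- The normal equations of an estimate, tested with a signal in the coordinate `i`. -/
theorem IsEstimate.normal_equation {μ : ℝ} {o : Fin T → Option (Fin n)}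
    {x xhat : EuclideanSpace ℝ (Fin T × Fin n)} {η : EuclideanSpace ℝ (Fin T)}
    (h : IsEstimate G μ (fun t => rowVec (o t)) (observe (fun t => rowVec (o t)) x η) xhat)
    (i : Fin n) (f : Fin T → ℝ) :
    ∑ t ∈ obs o i, (xhat (t, i) - x (t, i) - η t) * f t +
      μ * dirichlet G (fun t => xhat (t, i)) f = 0 := by
  classical
  -- A direction supported in coordinate `i` sees only the nodes of `obs o i` and one Dirichlet
  -- form.
  let d : EuclideanSpace ℝ (Fin T × Fin n) :=
    WithLp.toLp 2 fun p => if p.2 = i then f p.1 else 0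
  have hd : ∀ t j, d (t, j) = if j = i then f t else 0 := fun t j => rfl
  have h1 := inner_add_inner_eq_zero_of_forall_le _ _ h d
  rw [inner_smoothMatrix] at h1
  have h2 : ∑ j, dirichlet G (fun t => xhat (t, j)) (fun t => d (t, j)) =
      dirichlet G (fun t => xhat (t, i)) f := by
    rw [Finset.sum_eq_single i]
    · simp [hd]
    · intro j _ hj
      simp only [hd, if_neg hj]
      exact dirichlet_const_right _ 0
    · simp
  rw [h2] at h1
  rw [← h1]
  congr 1
  simp only [observe, PiLp.inner_apply, obs, Finset.sum_filter]
  refine Finset.sum_congr rfl fun t _ => ?_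
  simp only [PiLp.sub_apply, PiLp.add_apply, measMatrix_apply, hd]
  by_cases ht : o t = some i
  · simp [ht]
    ring
  · have : ∀ j, (if o t = some j then if j = i then f t else 0 else 0) = 0 := by
      intro j
      by_cases hj : j = i
      · subst hj; simp [ht]
      · simp [hj]
    simp [ht, this]

/-- The energy inequality behind the error bound, for scalars: `Γ` stands for the squared error on the
observed nodes, `Q` for the Dirichlet energy of the error, `p` and `b` for the noise and bias terms. -/
theorem energy_bound {Γ Q H s a lam μ p b : ℝ} (hlam : 0 < lam) (ha : a = μ * lam) (ha1 : 1 ≤ a)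
    (hH : 0 ≤ H) (hs : 0 ≤ s) (hΓ : 0 ≤ Γ) (hgap : lam * Γ ≤ Q)
    (hp : p ^ 2 ≤ Γ * H) (hb : b ^ 2 ≤ Q * s) (hE : Γ + μ * Q = p - μ * b) :
    Q / lam ≤ 4 * H / (1 + a) ^ 2 + 2 * s / lam := by
  have hμ : 0 < μ := by
    by_contra h
    nlinarith
  have hQ : 0 ≤ Q := le_trans (by positivity) hgap
  -- Weighted AM-GM: `Γ` cancels the left side of `hE`, and `a * Γ / 4 ≤ μ * Q / 4` by the gap. With
  -- another `μ * Q / 4` from the bias, half of `μ * Q` remains.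
  have hp' : p ≤ (1 + a / 4) * Γ + H / (4 + a) := by
    refine (le_abs_self p).trans (abs_le_of_sq_le_sq (hp.trans ?_) (by positivity))
    have : Γ * H = 4 * (((1 + a / 4) * Γ) * (H / (4 + a))) := by field_simp
    rw [this]
    nlinarith [sq_nonneg ((1 + a / 4) * Γ - H / (4 + a))]
  have hb' : -b ≤ Q / 4 + s :=
    (neg_le_abs b).trans (abs_le_of_sq_le_sq
      (hb.trans (by nlinarith [sq_nonneg (Q / 4 - s)])) (by positivity))
  have h1 : μ * Q / 2 ≤ H / (4 + a) + μ * s := by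
    have h2 : a * Γ ≤ μ * Q := by rw [ha, mul_assoc]; gcongr
    have h3 : μ * -b ≤ μ * (Q / 4 + s) := by gcongr
    nlinarith
  have h4 : Q / lam = 2 * (μ * Q / 2) / a := by rw [ha]; field_simp
  have h5 : 2 * H / (a * (4 + a)) ≤ 4 * H / (1 + a) ^ 2 := by
    rw [div_le_div_iff₀ (by positivity) (by positivity)]
    nlinarith [mul_nonneg hH (by nlinarith : 0 ≤ 2 * (a * (4 + a)) - (1 + a) ^ 2)]
  calc Q / lam ≤ 2 * (H / (4 + a) + μ * s) / a := by rw [h4]; gcongr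
    _ = 2 * H / (a * (4 + a)) + 2 * s / lam := by rw [ha]; field_simp
    _ ≤ _ := by gcongr

/-- The error in a single coordinate which is observed on the set `N` of nodes. -/
theorem coordinate_bound {N : Finset (Fin T)} (hN : N.Nonempty) {r lam μ : ℝ}
    (hr : (T : ℝ) ≤ r * N.card) (hlam : 0 < lam) (hμ : 1 ≤ μ * lam)
    (hgap : ∀ f : Fin T → ℝ, lam * ∑ t, (f t - (∑ s, f s) / T) ^ 2 ≤ dirichlet G f f)
    {x xhat η : Fin T → ℝ}
    (hE : ∀ f : Fin T → ℝ, ∑ t ∈ N, (xhat t - x t - η t) * f t + μ * dirichlet G xhat f = 0) :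
    ∑ t, (xhat t - x t) ^ 2 ≤
      4 * r * (4 * ∑ t ∈ N, η t ^ 2 / (1 + μ * lam) ^ 2 + 2 * dirichlet G x x / lam) +
        2 * r * ((∑ t ∈ N, η t) ^ 2 / N.card) := by
  have hm : (0 : ℝ) < N.card := by exact_mod_cast hN.card_pos
  have hmT : (N.card : ℝ) ≤ T := by
    exact_mod_cast (Finset.card_le_univ N).trans (Fintype.card_fin T).le
  have hT : T ≠ 0 := by
    rintro rfl
    norm_num at hmT
    simp [hmT] at hm
  have hr1 : 1 ≤ r := by
    by_contra h
    nlinarith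
  -- The penalty cannot see constants, so the mean noise on `N` passes undamped into the estimate
  -- and is split off.
  set κ := (∑ t ∈ N, η t) / N.card with hκ
  set g : Fin T → ℝ := fun t => xhat t - x t - κ with hg
  have hsum : ∑ t ∈ N, g t = 0 := by
    have h1 := hE fun _ => 1
    rw [dirichlet_const_right] at h1
    simp only [mul_one, mul_zero, add_zero, Finset.sum_sub_distrib] at h1
    simp only [hg, Finset.sum_sub_distrib, Finset.sum_const, nsmul_eq_mul]
    rw [hκ, mul_div_cancel₀ _ hm.ne']
    exact h1
  have hD : dirichlet G xhat g = dirichlet G g g + dirichlet G x g := by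
    have h1 : dirichlet G g g = dirichlet G (fun t => xhat t - x t) g :=
      dirichlet_sub_const_left _ _ _
    rw [h1, dirichlet_sub_left]
    ring
  have henergy : ∑ t ∈ N, g t ^ 2 + μ * dirichlet G g g =
      ∑ t ∈ N, g t * η t - μ * dirichlet G x g := by
    have h1 := hE g
    rw [hD] at h1
    have h2 : ∑ t ∈ N, (xhat t - x t - η t) * g t =
        ∑ t ∈ N, g t ^ 2 + κ * ∑ t ∈ N, g t - ∑ t ∈ N, g t * η t := by
      rw [Finset.mul_sum, ← Finset.sum_add_distrib, ← Finset.sum_sub_distrib]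
      refine Finset.sum_congr rfl fun t _ => ?_
      simp only [hg]
      ring
    rw [h2, hsum] at h1
    linarith
  set gb := (∑ s, g s) / T with hgb
  set V := ∑ t, (g t - gb) ^ 2 with hV
  have hVgap : lam * V ≤ dirichlet G g g := hgap g
  -- Since `g` sums to zero on `N`, the cross term vanishes. The variance thus bounds both the
  -- observed energy and the global mean `gb`.
  have hVN : ∑ t ∈ N, g t ^ 2 + N.card * gb ^ 2 ≤ V := by
    have h1 : ∑ t ∈ N, (g t - gb) ^ 2 = ∑ t ∈ N, g t ^ 2 + N.card * gb ^ 2 := by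
      have : ∀ t, (g t - gb) ^ 2 = g t ^ 2 - 2 * gb * g t + gb ^ 2 := fun t => by ring
      simp only [this, Finset.sum_add_distrib, Finset.sum_sub_distrib, ← Finset.mul_sum, hsum]
      simp
    rw [← h1]
    exact Finset.sum_le_sum_of_subset_of_nonneg (Finset.subset_univ N) fun _ _ _ => sq_nonneg _
  have hΓ : 0 ≤ ∑ t ∈ N, g t ^ 2 := Finset.sum_nonneg fun _ _ => sq_nonneg _
  have hH : 0 ≤ ∑ t ∈ N, η t ^ 2 := Finset.sum_nonneg fun _ _ => sq_nonneg _
  have hQ : V ≤ 4 * ∑ t ∈ N, η t ^ 2 / (1 + μ * lam) ^ 2 + 2 * dirichlet G x x / lam := by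
    have h1 := energy_bound hlam rfl hμ hH (dirichlet_self_nonneg (G := G) x) hΓ
      (by nlinarith [mul_nonneg hm.le (sq_nonneg gb)]) (Finset.sum_mul_sq_le_sq_mul_sq N g η)
      ((sq_dirichlet_le (G := G) x g).trans_eq (mul_comm _ _)) henergy
    rw [← Finset.sum_div, ← mul_div_assoc]
    refine le_trans ?_ h1
    rwa [le_div_iff₀ hlam, mul_comm]
  set W := 4 * ∑ t ∈ N, η t ^ 2 / (1 + μ * lam) ^ 2 + 2 * dirichlet G x x / lam with hW
  have hV0 : 0 ≤ V := Finset.sum_nonneg fun _ _ => sq_nonneg _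
  have hgsum : ∑ t, g t ^ 2 ≤ 2 * r * W := by
    have h1 := sum_sub_sq_eq g hT 0
    simp only [sub_zero] at h1
    have h2 : (T : ℝ) * gb ^ 2 ≤ r * V := by
      calc (T : ℝ) * gb ^ 2 ≤ r * N.card * gb ^ 2 := by gcongr
        _ = r * (N.card * gb ^ 2) := by ring
        _ ≤ r * V := by gcongr; linarith
    have h3 : V ≤ r * V := le_mul_of_one_le_left hV0 hr1
    have h4 : r * V ≤ r * W := by gcongr
    rw [h1]
    linarith
  have hκT : (T : ℝ) * κ ^ 2 ≤ r * ((∑ t ∈ N, η t) ^ 2 / N.card) := by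
    calc (T : ℝ) * κ ^ 2 ≤ r * N.card * κ ^ 2 := by gcongr
      _ = _ := by rw [hκ]; field_simp
  have hfin : ∑ t, (xhat t - x t) ^ 2 ≤ ∑ t, (2 * g t ^ 2 + 2 * κ ^ 2) := by
    refine Finset.sum_le_sum fun t _ => ?_
    have : xhat t - x t = g t + κ := by simp [hg]
    rw [this]
    nlinarith [sq_nonneg (g t - κ)]
  rw [Finset.sum_add_distrib, ← Finset.mul_sum] at hfin
  simp only [Finset.sum_const, Finset.card_univ, Fintype.card_fin, nsmul_eq_mul] at hfin
  nlinarith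

/-- The error bound in terms of the noise on the observed nodes, for a graph with spectral gap `lam`. -/
theorem IsEstimate.norm_sq_le {μ lam r S : ℝ} {o : Fin T → Option (Fin n)}
    {x xhat : EuclideanSpace ℝ (Fin T × Fin n)} {η : EuclideanSpace ℝ (Fin T)}
    (h : IsEstimate G μ (fun t => rowVec (o t)) (observe (fun t => rowVec (o t)) x η) xhat)
    (hobs : ∀ i, (obs o i).Nonempty) (hr : ∀ i, (T : ℝ) ≤ r * (obs o i).card) (hr0 : 0 ≤ r)
    (hlam : 0 < lam) (hμ : 1 ≤ μ * lam)
    (hgap : ∀ f : Fin T → ℝ, lam * ∑ t, (f t - (∑ s, f s) / T) ^ 2 ≤ dirichlet G f f)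
    (hS : roughness G x ≤ S) :
    ‖xhat - x‖ ^ 2 ≤
      4 * r * (4 * (∑ i, ∑ t ∈ obs o i, η t ^ 2) / (1 + μ * lam) ^ 2 + 2 * S / lam) +
        2 * r * ∑ i, (∑ t ∈ obs o i, η t) ^ 2 / (obs o i).card := by
  have h1 : ‖xhat - x‖ ^ 2 = ∑ i, ∑ t, (xhat (t, i) - x (t, i)) ^ 2 := by
    rw [EuclideanSpace.norm_sq_eq, Fintype.sum_prod_type, Finset.sum_comm]
    simp
  rw [h1]
  refine (Finset.sum_le_sum fun i _ => coordinate_bound (hobs i) (hr i) hlam hμ hgap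
    (h.normal_equation i)).trans ?_
  simp only [Finset.sum_add_distrib, ← Finset.mul_sum, ← Finset.sum_div]
  rw [← roughness_eq, mul_div_assoc, mul_div_assoc, mul_div_assoc]
  gcongr

end Deterministic

/-! ### Quadratic forms of subgaussian vectors -/

section Noise

/-- Completing the square writes `exp` of a square as a Gaussian mixture of the exponentials `exp (s
* z)`, whose means subgaussianity controls. -/
theorem lintegral_exp_mul_sub_mul_sq {b : ℝ} (hb : 0 < b) (z : ℝ) :
    ∫⁻ s : ℝ, ENNReal.ofReal (Real.exp (s * z - b * s ^ 2)) =
      ENNReal.ofReal (√(Real.pi / b)) * ENNReal.ofReal (Real.exp (z ^ 2 / (4 * b))) := by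
  have h1 : ∀ s : ℝ, ENNReal.ofReal (Real.exp (s * z - b * s ^ 2)) =
      ENNReal.ofReal (Real.exp (-b * (s - z / (2 * b)) ^ 2)) *
        ENNReal.ofReal (Real.exp (z ^ 2 / (4 * b))) := by
    intro s
    rw [← ENNReal.ofReal_mul (Real.exp_nonneg _), ← Real.exp_add]
    congr 2
    field_simp
    ring
  simp_rw [h1]
  rw [lintegral_mul_const' _ _ ENNReal.ofReal_ne_top,
    lintegral_sub_right_eq_self (fun s : ℝ => ENNReal.ofReal (Real.exp (-b * s ^ 2))),
    ← ofReal_integral_eq_lintegral_ofReal (integrable_exp_neg_mul_sq hb)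
      (ae_of_all _ fun _ => Real.exp_nonneg _), integral_gaussian]

variable {Ω : Type*} [MeasurableSpace Ω] {P : Measure Ω}

/-- The squared exponential moment of a subgaussian variable. -/
theorem lintegral_exp_sq_le [IsProbabilityMeasure P] {Z : Ω → ℝ} {σ : ℝ} (hσ : 0 < σ)
    (hZm : Measurable Z) (hZ : HasSubgaussianMGF Z (Real.toNNReal (σ ^ 2)) P) :
    ∫⁻ ω, ENNReal.ofReal (Real.exp (Z ω ^ 2 / (4 * σ ^ 2))) ∂P ≤ 2 := by
  have hb : 0 < σ ^ 2 := by positivity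
  set c := ENNReal.ofReal (√(Real.pi / σ ^ 2)) with hc
  have hc0 : c ≠ 0 := by
    rw [hc, Ne, ENNReal.ofReal_eq_zero, not_le]
    positivity
  have hct : c ≠ ∞ := ENNReal.ofReal_ne_top
  have h1 : c * ∫⁻ ω, ENNReal.ofReal (Real.exp (Z ω ^ 2 / (4 * σ ^ 2))) ∂P =
      ∫⁻ s : ℝ, ∫⁻ ω, ENNReal.ofReal (Real.exp (s * Z ω - σ ^ 2 * s ^ 2)) ∂P := by
    rw [← lintegral_const_mul' _ _ hct]
    simp_rw [hc, ← lintegral_exp_mul_sub_mul_sq hb]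
    refine lintegral_lintegral_swap ?_
    fun_prop
  -- The term `s * 0` puts the bound in the shape of the Gaussian integral, now with half the
  -- curvature; the normalizing constants differ by `√2 ≤ 2`.
  have h2 : ∀ s : ℝ, ∫⁻ ω, ENNReal.ofReal (Real.exp (s * Z ω - σ ^ 2 * s ^ 2)) ∂P ≤
      ENNReal.ofReal (Real.exp (s * 0 - σ ^ 2 / 2 * s ^ 2)) := by
    intro s
    have h3 : ∀ ω, ENNReal.ofReal (Real.exp (s * Z ω - σ ^ 2 * s ^ 2)) =
        ENNReal.ofReal (Real.exp (s * Z ω)) * ENNReal.ofReal (Real.exp (-(σ ^ 2 * s ^ 2))) := by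
      intro ω
      rw [← ENNReal.ofReal_mul (Real.exp_nonneg _), ← Real.exp_add, sub_eq_add_neg]
    simp_rw [h3]
    rw [lintegral_mul_const' _ _ ENNReal.ofReal_ne_top,
      ← ofReal_integral_eq_lintegral_ofReal (hZ.integrable_exp_mul s)
        (ae_of_all _ fun _ => Real.exp_nonneg _), ← ENNReal.ofReal_mul
        (integral_nonneg fun _ => Real.exp_nonneg _)]
    refine ENNReal.ofReal_le_ofReal ?_
    have h4 := hZ.mgf_le s
    rw [mgf, Real.coe_toNNReal _ hb.le] at h4
    calc _ ≤ Real.exp (σ ^ 2 * s ^ 2 / 2) * Real.exp (-(σ ^ 2 * s ^ 2)) := by gcongr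
      _ = _ := by rw [← Real.exp_add]; congr 1; ring
  have h5 := h1.trans_le (lintegral_mono h2)
  rw [lintegral_exp_mul_sub_mul_sq (by positivity : 0 < σ ^ 2 / 2)] at h5
  have h6 : ENNReal.ofReal (√(Real.pi / (σ ^ 2 / 2))) *
      ENNReal.ofReal (Real.exp (0 ^ 2 / (4 * (σ ^ 2 / 2)))) ≤ c * 2 := by
    have : (2 : ℝ≥0∞) = ENNReal.ofReal 2 := by simp
    rw [hc, this, ← ENNReal.ofReal_mul (Real.sqrt_nonneg _), ← ENNReal.ofReal_mul (Real.sqrt_nonneg _)]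
    refine ENNReal.ofReal_le_ofReal ?_
    simp only [ne_eq, OfNat.ofNat_ne_zero, not_false_eq_true, zero_pow, zero_div, Real.exp_zero,
      mul_one]
    refine Real.sqrt_le_iff.mpr ⟨by positivity, ?_⟩
    rw [mul_pow, Real.sq_sqrt (by positivity)]
    have : Real.pi / (σ ^ 2 / 2) = Real.pi / σ ^ 2 * 2 := by field_simp
    rw [this]
    have : 0 ≤ Real.pi / σ ^ 2 := by positivity
    linarith
  exact (ENNReal.mul_le_mul_iff_right hc0 hct).mp (h5.trans h6)

/-- A tail bound for convex combinations of squared marginals of a subgaussian vector. -/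
theorem IsSubgaussianVector.measure_sum_sq_gt_le [IsProbabilityMeasure P] {m : ℕ} {σ δ : ℝ}
    (hσ : 0 ≤ σ) (hδ : 0 < δ) {Y : Ω → EuclideanSpace ℝ (Fin m)} (hYm : Measurable Y)
    (hY : IsSubgaussianVector P σ Y) {ι : Type*} (K : Finset ι) {w : ι → ℝ} (hw : ∀ k ∈ K, 0 ≤ w k)
    (hw1 : ∑ k ∈ K, w k = 1) {v : ι → EuclideanSpace ℝ (Fin m)} (hv : ∀ k ∈ K, ‖v k‖ = 1) :
    P {ω | 4 * σ ^ 2 * Real.log (2 / δ) < ∑ k ∈ K, w k * inner ℝ (v k) (Y ω) ^ 2} ≤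
      ENNReal.ofReal δ := by
  -- For `σ = 0` the exponent below would divide by zero; there the marginals vanish almost surely.
  rcases hσ.eq_or_lt with rfl | hσ
  · have h0 : ∀ᵐ ω ∂P, ∀ k ∈ K, inner ℝ (v k) (Y ω) = 0 := by
      rw [Finset.eventually_all]
      intro k hk
      have := hY (v k) (hv k hk)
      simp only [ne_eq, OfNat.ofNat_ne_zero, not_false_eq_true, zero_pow, Real.toNNReal_zero] at this
      exact this.ae_eq_zero_of_hasSubgaussianMGF_zero
    refine le_of_eq_of_le ?_ zero_le
    refine measure_mono_null ?_ h0
    intro ω hω h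
    simp only [Set.mem_ofPred_eq] at hω h
    rw [Finset.sum_eq_zero fun k hk => by simp [h k hk]] at hω
    simp at hω
  · have hs : 0 < σ ^ 2 := by positivity
    have hm : ∀ k, Measurable fun ω => inner ℝ (v k) (Y ω) := fun k => by fun_prop
    have h1 : ∫⁻ ω, ENNReal.ofReal
        (Real.exp ((∑ k ∈ K, w k * inner ℝ (v k) (Y ω) ^ 2) / (4 * σ ^ 2))) ∂P ≤ 2 := by
      calc _ ≤ ∫⁻ ω, ∑ k ∈ K, ENNReal.ofReal (w k) *
            ENNReal.ofReal (Real.exp (inner ℝ (v k) (Y ω) ^ 2 / (4 * σ ^ 2))) ∂P := by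
            refine lintegral_mono fun ω => ?_
            -- Jensen reduces the joint moment to single marginals, so no independence among the
            -- noise entries is needed.
            have := convexOn_exp.map_sum_le (t := K) (w := w)
              (p := fun k => inner ℝ (v k) (Y ω) ^ 2 / (4 * σ ^ 2)) hw hw1 (by simp)
            simp only [smul_eq_mul] at this
            have h2 : (∑ k ∈ K, w k * inner ℝ (v k) (Y ω) ^ 2) / (4 * σ ^ 2) =
                ∑ k ∈ K, w k * (inner ℝ (v k) (Y ω) ^ 2 / (4 * σ ^ 2)) := by
              rw [Finset.sum_div]
              exact Finset.sum_congr rfl fun _ _ => by ring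
            rw [h2]
            refine (ENNReal.ofReal_le_ofReal this).trans_eq ?_
            rw [ENNReal.ofReal_sum_of_nonneg fun k hk => mul_nonneg (hw k hk) (Real.exp_nonneg _)]
            exact Finset.sum_congr rfl fun k hk => ENNReal.ofReal_mul (hw k hk)
        _ = ∑ k ∈ K, ENNReal.ofReal (w k) *
            ∫⁻ ω, ENNReal.ofReal (Real.exp (inner ℝ (v k) (Y ω) ^ 2 / (4 * σ ^ 2))) ∂P := by
            rw [lintegral_finsetSum' _ fun k _ => by fun_prop]
            exact Finset.sum_congr rfl fun k _ => lintegral_const_mul' _ _ ENNReal.ofReal_ne_top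
        _ ≤ ∑ k ∈ K, ENNReal.ofReal (w k) * 2 := by
            refine Finset.sum_le_sum fun k hk => ?_
            gcongr
            exact lintegral_exp_sq_le hσ (hm k) (hY _ (hv k hk))
        _ = 2 := by
            rw [← Finset.sum_mul, ← ENNReal.ofReal_sum_of_nonneg hw, hw1]
            simp
    have h2 := (mul_meas_ge_le_lintegral₀ (μ := P) (f := fun ω => ENNReal.ofReal
        (Real.exp ((∑ k ∈ K, w k * inner ℝ (v k) (Y ω) ^ 2) / (4 * σ ^ 2)))) (by fun_prop)
        (ENNReal.ofReal (2 / δ))).trans h1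
    have h3 : P {ω | 4 * σ ^ 2 * Real.log (2 / δ) < ∑ k ∈ K, w k * inner ℝ (v k) (Y ω) ^ 2} ≤
        P {ω | ENNReal.ofReal (2 / δ) ≤ ENNReal.ofReal
          (Real.exp ((∑ k ∈ K, w k * inner ℝ (v k) (Y ω) ^ 2) / (4 * σ ^ 2)))} := by
      refine measure_mono fun ω hω => ?_
      refine ENNReal.ofReal_le_ofReal ?_
      rw [← Real.log_le_iff_le_exp (by positivity), le_div_iff₀ (by positivity), mul_comm]
      exact le_of_lt hω
    refine h3.trans ?_
    have h4 : ENNReal.ofReal (2 / δ) * ENNReal.ofReal δ = 2 := by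
      rw [← ENNReal.ofReal_mul (by positivity), div_mul_cancel₀ _ hδ.ne']
      simp
    replace h2 := h2.trans_eq h4.symm
    exact (ENNReal.mul_le_mul_iff_right (by simpa using hδ) ENNReal.ofReal_ne_top).mp h2

end Noise

/-! ### The random rows -/

section Rows

/-- The probability of a row under the sparse row law. -/
noncomputable def rowWeight (n : ℕ) (θ : ℝ) : Option (Fin n) → ℝ
  | none => 1 - θ
  | some _ => θ / n

variable {T n : ℕ} {θ : ℝ}

theorem rowWeight_nonneg (h0 : 0 < θ) (h1 : θ ≤ 1) (o : Option (Fin n)) : 0 ≤ rowWeight n θ o := by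
  cases o
  · simpa [rowWeight] using h1
  · simp only [rowWeight]; positivity

/-- Expectation of a product over independent nodes, in finite form: the sum over patterns factors
into a power. It supplies the moment generating functions for the Chernoff bounds. -/
theorem sum_rowWeight_mul_prod (φ : Option (Fin n) → ℝ) :
    ∑ o : Fin T → Option (Fin n), (∏ t, rowWeight n θ (o t)) * ∏ t, φ (o t) =
      ((1 - θ) * φ none + ∑ i, θ / n * φ (some i)) ^ T := by
  simp_rw [← Finset.prod_mul_distrib]
  rw [← Fintype.sum_pow (fun j => rowWeight n θ j * φ j) T, Fintype.sum_option]
  rfl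

theorem sum_prod_rowWeight (hn : 0 < n) :
    ∑ o : Fin T → Option (Fin n), ∏ t, rowWeight n θ (o t) = 1 := by
  have hn' : (n : ℝ) ≠ 0 := by positivity
  have h := sum_rowWeight_mul_prod (T := T) (n := n) (θ := θ) fun _ => 1
  simp only [Finset.prod_const_one, mul_one] at h
  rw [h]
  simp [mul_div_cancel₀ _ hn']

open scoped Classical in
/-- The exponential Markov inequality for the product weights of the rows. -/
theorem sum_filter_prod_rowWeight_le (h0 : 0 < θ) (h1 : θ ≤ 1) {B : (Fin T → Option (Fin n)) → Prop}
    {φ : Option (Fin n) → ℝ} (hφ : ∀ j, 0 ≤ φ j) {c : ℝ} (hc : 0 ≤ c)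
    (h : ∀ o, B o → 1 ≤ c * ∏ t, φ (o t)) :
    ∑ o with B o, ∏ t, rowWeight n θ (o t) ≤
      c * ((1 - θ) * φ none + ∑ i, θ / n * φ (some i)) ^ T := by
  have hw : ∀ o : Fin T → Option (Fin n), 0 ≤ ∏ t, rowWeight n θ (o t) := fun o =>
    Finset.prod_nonneg fun t _ => rowWeight_nonneg h0 h1 _
  rw [← sum_rowWeight_mul_prod, Finset.mul_sum, Finset.sum_filter]
  refine Finset.sum_le_sum fun o _ => ?_
  have h2 : 0 ≤ ∏ t, φ (o t) := Finset.prod_nonneg fun t _ => hφ _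
  split_ifs with hB
  · nlinarith [h o hB, hw o]
  · have := hw o
    positivity

open scoped Classical in
/-- Chernoff's lower tail bound for the number of observations of a coordinate. -/
theorem sum_filter_card_obs_lt_le (h0 : 0 < θ) (h1 : θ ≤ 1) (i : Fin n) :
    ∑ o : Fin T → Option (Fin n) with ((obs o i).card : ℝ) < θ / n * T / 2,
      ∏ t, rowWeight n θ (o t) ≤ Real.exp (-(θ / n * T / 8)) := by
  have hn : (0 : ℝ) < n := by exact_mod_cast i.pos
  have hp : θ / n * n = θ := div_mul_cancel₀ _ hn.ne'
  have hprod : ∀ o : Fin T → Option (Fin n),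
      ∏ t, (if o t = some i then Real.exp (-(1 / 2)) else 1) =
        Real.exp (-((obs o i).card / 2)) := by
    intro o
    rw [← Finset.prod_filter, Finset.prod_const, ← Real.exp_nat_mul]
    congr 1
    simp only [obs]
    ring
  refine (sum_filter_prod_rowWeight_le h0 h1
    (φ := fun j => if j = some i then Real.exp (-(1 / 2)) else 1) (fun j => by positivity)
    (Real.exp_nonneg (θ / n * T / 4)) fun o ho => ?_).trans ?_
  · rw [hprod, ← Real.exp_add]
    exact Real.one_le_exp (by linarith)
  · have h2 : ∑ j, θ / n * (if (some j : Option (Fin n)) = some i then Real.exp (-(1 / 2)) else 1) =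
        θ - θ / n * (1 - Real.exp (-(1 / 2))) := by
      have : ∀ j, θ / n * (if (some j : Option (Fin n)) = some i then Real.exp (-(1 / 2)) else 1) =
          θ / n - if j = i then θ / n * (1 - Real.exp (-(1 / 2))) else 0 := by
        intro j
        by_cases hj : j = i
        · subst hj; simp; ring
        · simp [hj]
      simp only [this, Finset.sum_sub_distrib, Finset.sum_ite_eq', Finset.mem_univ, if_true,
        Finset.sum_const, Finset.card_univ, Fintype.card_fin, nsmul_eq_mul]
      rw [mul_comm (n : ℝ), hp]
    -- With tilt `-1/2` each node contributes at most `exp (-(3/8) * θ / n)`; against the threshold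
    -- factor `exp (θ / n * T / 4)` the rate is `3/8 - 1/4 = 1/8`.
    have h3 : Real.exp (-(1 / 2)) ≤ 5 / 8 := by
      have := Real.quadratic_le_exp_of_nonneg (x := 1 / 2) (by norm_num)
      rw [Real.exp_neg, inv_le_comm₀ (Real.exp_pos _) (by norm_num)]
      linarith
    have h4 : (1 - θ) * (if (none : Option (Fin n)) = some i then Real.exp (-(1 / 2)) else 1) +
        (θ - θ / n * (1 - Real.exp (-(1 / 2)))) ≤ Real.exp (-(θ / n * (3 / 8))) := by
      have h5 := Real.add_one_le_exp (-(θ / n * (3 / 8)))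
      have h6 : 0 < θ / n := by positivity
      simp only [reduceCtorEq, if_false]
      nlinarith
    rw [h2]
    have h7 : 0 ≤ (1 - θ) * (if (none : Option (Fin n)) = some i then Real.exp (-(1 / 2)) else 1) +
        (θ - θ / n * (1 - Real.exp (-(1 / 2)))) := by
      have h6 : θ / n ≤ θ := div_le_self h0.le (by exact_mod_cast i.pos)
      have h8 : 0 < θ / n := by positivity
      simp only [reduceCtorEq, if_false]
      nlinarith [Real.exp_pos (-(1 / 2))]
    calc _ ≤ Real.exp (θ / n * T / 4) * Real.exp (-(θ / n * (3 / 8))) ^ T := by gcongr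
      _ = _ := by rw [← Real.exp_nat_mul, ← Real.exp_add]; congr 1; ring

open scoped Classical in
/-- Chernoff's upper tail bound for the total number of observations. -/
theorem sum_filter_lt_sum_card_obs_le (hn : 0 < n) (h0 : 0 < θ) (h1 : θ ≤ 1) :
    ∑ o : Fin T → Option (Fin n) with 4 * θ * T < ∑ i, ((obs o i).card : ℝ),
      ∏ t, rowWeight n θ (o t) ≤ Real.exp (-(2 * θ * T)) := by
  have hn' : (n : ℝ) ≠ 0 := by positivity
  have hprod : ∀ o : Fin T → Option (Fin n), ∏ t, (if o t = none then 1 else Real.exp 1) =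
      Real.exp (∑ i, ((obs o i).card : ℝ)) := by
    intro o
    have h2 : ∑ i, ((obs o i).card : ℝ) = ∑ t, if o t = none then 0 else 1 := by
      simp only [obs, Finset.card_filter, Nat.cast_sum]
      rw [Finset.sum_comm]
      refine Finset.sum_congr rfl fun t _ => ?_
      cases o t <;> simp
    rw [h2, Real.exp_sum]
    refine Finset.prod_congr rfl fun t _ => ?_
    split_ifs <;> simp
  refine (sum_filter_prod_rowWeight_le h0 h1
    (φ := fun j => if j = none then 1 else Real.exp 1) (fun j => by positivity)
    (Real.exp_nonneg (-(4 * θ * T))) fun o ho => ?_).trans ?_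
  · rw [hprod, ← Real.exp_add]
    exact Real.one_le_exp (by linarith)
  -- With tilt `1`, the bound `e < 3` gives rate `4 - 2 = 2`.
  · have h4 : (1 - θ) * 1 + θ * Real.exp 1 ≤ Real.exp (2 * θ) := by
      have h5 := Real.add_one_le_exp (2 * θ)
      have h6 := Real.exp_one_lt_three
      nlinarith
    have h7 : 0 ≤ (1 - θ) * 1 + θ * Real.exp 1 := by
      have := Real.exp_pos 1
      nlinarith [mul_pos h0 this]
    have h8 : (1 - θ) * (if (none : Option (Fin n)) = none then 1 else Real.exp 1) +
        ∑ i : Fin n, θ / n * (if (some i : Option (Fin n)) = none then 1 else Real.exp 1) =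
        (1 - θ) * 1 + θ * Real.exp 1 := by
      simp
      field_simp
    rw [h8]
    calc _ ≤ Real.exp (-(4 * θ * T)) * Real.exp (2 * θ) ^ T := by gcongr
      _ = _ := by rw [← Real.exp_nat_mul, ← Real.exp_add]; congr 1; ring

theorem rowVec_injective : Function.Injective (rowVec : Option (Fin n) → Fin n → ℝ) := by
  intro a b h
  have h1 : ∀ i, a = some i ↔ b = some i := by
    intro i
    have := congrFun h i
    simp only [rowVec] at this
    by_cases ha : a = some i <;> by_cases hb : b = some i <;> simp_all
  exact Option.ext h1

theorem sparseRowLaw_singleton (hn : 0 < n) (o : Option (Fin n)) :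
    sparseRowLaw n θ {rowVec o} = ENNReal.ofReal (rowWeight n θ o) := by
  have hnone : (0 : Fin n → ℝ) = rowVec none := by ext i; simp [rowVec]
  have hsome : ∀ i : Fin n, (Pi.single i (1 : ℝ) : Fin n → ℝ) = rowVec (some i) := by
    intro i
    ext j
    simp [rowVec, Pi.single_apply, eq_comm]
  have hd : ∀ a : Option (Fin n), Measure.dirac (rowVec a : Fin n → ℝ) {rowVec o} =
      if a = o then 1 else 0 := by
    intro a
    rw [Measure.dirac_apply' _ (measurableSet_singleton _)]
    by_cases h : a = o
    · simp [h]
    · simp [h, rowVec_injective.eq_iff]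
  simp only [sparseRowLaw, Measure.add_apply, Measure.smul_apply, Measure.finsetSum_apply, hnone,
    hsome, hd, smul_eq_mul]
  cases o with
  | none => simp [rowWeight]
  | some i =>
    simp only [reduceCtorEq, if_false, Option.some.injEq, Finset.sum_ite_eq', Finset.mem_univ,
      if_true, rowWeight]
    rw [ENNReal.ofReal_div_of_pos (by positivity), ENNReal.div_eq_inv_mul]
    simp [mul_comm]

variable {Ω : Type*} [MeasurableSpace Ω] {P : Measure Ω} {σ : ℝ} {C : Fin T → Ω → Fin n → ℝ}
  {η : Ω → EuclideanSpace ℝ (Fin T)}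

/-- Independence makes pattern probabilities products of atom masses, so the row estimates become
finite weighted sums. -/
theorem SparseModel.measureReal_rows_eq (h : SparseModel P θ σ C η) (hn : 0 < n) (h0 : 0 < θ)
    (h1 : θ ≤ 1) (o : Fin T → Option (Fin n)) :
    P.real ((fun ω t => C t ω) ⁻¹' {fun t => rowVec (o t)}) = ∏ t, rowWeight n θ (o t) := by
  have h2 : (fun ω t => C t ω) ⁻¹' {fun t => rowVec (o t)} =
      ⋂ t ∈ Finset.univ, C t ⁻¹' {rowVec (o t)} := by
    ext ω
    simp [funext_iff]
  have h3 := (iIndepFun_iff_measure_inter_preimage_eq_mul.mp h.indep_rows) Finset.univ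
    (sets := fun t => {rowVec (o t)}) fun t _ => measurableSet_singleton _
  rw [measureReal_def, h2, h3, ENNReal.toReal_prod]
  refine Finset.prod_congr rfl fun t _ => ?_
  rw [← Measure.map_apply (h.measurable_row t) (measurableSet_singleton _), h.law_row,
    sparseRowLaw_singleton hn, ENNReal.toReal_ofReal (rowWeight_nonneg h0 h1 _)]

end Rows

/-! ### The good event -/

section GoodEvent

variable {T n : ℕ} {θ σ δ : ℝ} {Ω : Type*} [MeasurableSpace Ω] {P : Measure Ω}
  [IsProbabilityMeasure P]

/-- The noise vectors whose energy on the observed nodes and whose normalized sums over the nodes at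
which a coordinate is observed are controlled. -/
def goodNoise (o : Fin T → Option (Fin n)) (R : ℝ) : Set (EuclideanSpace ℝ (Fin T)) :=
  {y | ∑ i, ∑ t ∈ obs o i, y t ^ 2 ≤ (∑ i, ((obs o i).card : ℝ)) * R ∧
    ∑ i, (∑ t ∈ obs o i, y t) ^ 2 / (obs o i).card ≤ n * R}

theorem measurableSet_goodNoise (o : Fin T → Option (Fin n)) (R : ℝ) :
    MeasurableSet (goodNoise o R) := by
  have h1 : Measurable fun y : EuclideanSpace ℝ (Fin T) => ∑ i, ∑ t ∈ obs o i, y t ^ 2 := by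
    fun_prop
  have h2 : Measurable fun y : EuclideanSpace ℝ (Fin T) =>
      ∑ i, (∑ t ∈ obs o i, y t) ^ 2 / ((obs o i).card : ℝ) := by
    fun_prop
  exact (measurableSet_le h1 measurable_const).inter (measurableSet_le h2 measurable_const)

/-- As `log (1 / δ) ≥ 1`, it absorbs `log 4`. The `δ / 2` is the share of each of two noise events;
the factor 3 turns the tail constant 4 into 12. -/
theorem log_four_div_le (hδ : 0 < δ) (hδ1 : δ < Real.exp (-1)) :
    Real.log (2 / (δ / 2)) ≤ 3 * Real.log (1 / δ) := by
  have h1 : 1 ≤ Real.log (1 / δ) := by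
    rw [Real.le_log_iff_exp_le (by positivity), le_div_iff₀ hδ]
    calc Real.exp 1 * δ ≤ Real.exp 1 * Real.exp (-1) := by gcongr
      _ = 1 := by rw [← Real.exp_add]; simp
  have h2 : 2 / (δ / 2) = 2 * 2 * (1 / δ) := by field_simp
  rw [h2, Real.log_mul (by norm_num) (by positivity), Real.log_mul (by norm_num) (by norm_num)]
  have := Real.log_two_lt_d9
  linarith

/-- A subgaussian noise vector is good with high probability. -/
theorem IsSubgaussianVector.measureReal_goodNoise_ge (hn : 0 < n) (hσ : 0 ≤ σ) (hδ : 0 < δ)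
    (hδ1 : δ < Real.exp (-1)) {Y : Ω → EuclideanSpace ℝ (Fin T)} (hYm : Measurable Y)
    (hY : IsSubgaussianVector P σ Y) {o : Fin T → Option (Fin n)} (ho : ∀ i, (obs o i).Nonempty) :
    1 - δ ≤ P.real (Y ⁻¹' goodNoise o (12 * σ ^ 2 * Real.log (1 / δ))) := by
  set R := 12 * σ ^ 2 * Real.log (1 / δ) with hR
  have hR' : 4 * σ ^ 2 * Real.log (2 / (δ / 2)) ≤ R := by
    calc _ ≤ 4 * σ ^ 2 * (3 * Real.log (1 / δ)) := by
          gcongr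
          exact log_four_div_le hδ hδ1
      _ = R := by rw [hR]; ring
  have hcard : ∀ i, (0 : ℝ) < (obs o i).card := fun i => by exact_mod_cast (ho i).card_pos
  have hK : 0 < ∑ i, ((obs o i).card : ℝ) :=
    Finset.sum_pos (fun i _ => hcard i) ⟨⟨0, hn⟩, Finset.mem_univ _⟩
  have hn' : (0 : ℝ) < n := by exact_mod_cast hn
  -- Noise energy: uniform weights on the observed pairs `(i, t)`, with standard basis vectors.
  have hA := hY.measure_sum_sq_gt_le hσ (half_pos hδ) hYm
    (Finset.univ.sigma (obs o)) (w := fun _ => (∑ i, ((obs o i).card : ℝ))⁻¹)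
    (fun _ _ => by positivity)
    (by rw [Finset.sum_sigma]; simp [← Finset.sum_mul, mul_inv_cancel₀ hK.ne'])
    (v := fun k => EuclideanSpace.single k.2 1) (fun k _ => by simp)
  -- Normalized sums: weight `1 / n` per coordinate, with the normalized indicator of its
  -- observation set.
  have hB := hY.measure_sum_sq_gt_le hσ (half_pos hδ) hYm
    (Finset.univ : Finset (Fin n)) (w := fun _ => (n : ℝ)⁻¹)
    (fun _ _ => by positivity) (by simp [mul_inv_cancel₀ hn'.ne'])
    (v := fun i => WithLp.toLp 2 fun t => if t ∈ obs o i then (√((obs o i).card : ℝ))⁻¹ else 0)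
    (fun i _ => by
      rw [EuclideanSpace.norm_eq, Real.sqrt_eq_one]
      have : ∀ t, ‖(if t ∈ obs o i then (√((obs o i).card : ℝ))⁻¹ else 0)‖ ^ 2 =
          if t ∈ obs o i then ((obs o i).card : ℝ)⁻¹ else 0 := by
        intro t
        split_ifs
        · rw [Real.norm_eq_abs, sq_abs, inv_pow, Real.sq_sqrt (hcard i).le]
        · simp
      simp only [this, Finset.sum_ite_mem, Finset.univ_inter, Finset.sum_const, nsmul_eq_mul]
      exact mul_inv_cancel₀ (hcard i).ne')
  have hsub : (Y ⁻¹' goodNoise o R)ᶜ ⊆ {ω | 4 * σ ^ 2 * Real.log (2 / (δ / 2)) <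
        ∑ k ∈ Finset.univ.sigma (obs o), (∑ i, ((obs o i).card : ℝ))⁻¹ *
          inner ℝ (EuclideanSpace.single k.2 1) (Y ω) ^ 2} ∪
      {ω | 4 * σ ^ 2 * Real.log (2 / (δ / 2)) < ∑ i : Fin n, (n : ℝ)⁻¹ * inner ℝ
        (WithLp.toLp 2 fun t => if t ∈ obs o i then (√((obs o i).card : ℝ))⁻¹ else 0) (Y ω) ^ 2} := by
    intro ω hω
    by_contra hcon
    simp only [Set.mem_union, Set.mem_ofPred_eq, not_or, not_lt] at hcon
    refine hω ⟨?_, ?_⟩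
    · have h1 := hcon.1.trans hR'
      rw [← Finset.mul_sum, Finset.sum_sigma, inv_mul_le_iff₀ hK] at h1
      simpa [EuclideanSpace.inner_single_left] using h1
    · have h1 := hcon.2.trans hR'
      rw [← Finset.mul_sum, inv_mul_le_iff₀ hn'] at h1
      refine le_trans (le_of_eq ?_) h1
      refine Finset.sum_congr rfl fun i _ => ?_
      have h2 : inner ℝ (WithLp.toLp 2 fun t =>
          if t ∈ obs o i then (√((obs o i).card : ℝ))⁻¹ else 0) (Y ω) =
          (∑ t ∈ obs o i, Y ω t) * (√((obs o i).card : ℝ))⁻¹ := by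
        simp [PiLp.inner_apply, Finset.sum_mul]
      rw [h2, mul_pow, inv_pow, Real.sq_sqrt (hcard i).le, div_eq_mul_inv]
  have h3 : P (Y ⁻¹' goodNoise o R)ᶜ ≤ ENNReal.ofReal δ := by
    refine (measure_mono hsub).trans ((measure_union_le _ _).trans ((add_le_add hA hB).trans_eq ?_))
    rw [← ENNReal.ofReal_add (by positivity) (by positivity), add_halves]
  have h5 : P.real (Y ⁻¹' goodNoise o R)ᶜ ≤ δ := by
    rw [measureReal_def]
    exact ENNReal.toReal_le_of_le_ofReal hδ.le h3
  rw [probReal_compl_eq_one_sub (hYm (measurableSet_goodNoise o R))] at h5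
  linarith

/-- The row patterns in which every coordinate is observed often and few rows are nonzero. -/
def GoodRows (θ : ℝ) (o : Fin T → Option (Fin n)) : Prop :=
  (∀ i, θ / n * T / 2 ≤ (obs o i).card) ∧ ∑ i, ((obs o i).card : ℝ) ≤ 4 * θ * T

/-- Turns the sample size condition into the exponents of the two Chernoff bounds: failure `δ / n`
per coordinate and `δ` for the total count. -/
theorem log_bounds (hn : 0 < n) (h0 : 0 < θ) (hδ : 0 < δ) (hδ1 : δ < Real.exp (-1))
    (hT : 8 * n / θ * Real.log (n / δ) ≤ T) :
    0 < (T : ℝ) ∧ Real.log (n / δ) ≤ θ / n * T / 8 ∧ Real.log (1 / δ) ≤ 2 * θ * T := by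
  have hn' : (1 : ℝ) ≤ n := by exact_mod_cast hn
  have h1 : δ < 1 := hδ1.trans (Real.exp_lt_one_iff.mpr (by norm_num))
  have h2 : 0 < Real.log (1 / δ) := Real.log_pos (by rwa [lt_div_iff₀ hδ, one_mul])
  have h3 : Real.log (1 / δ) ≤ Real.log (n / δ) := Real.log_le_log (by positivity) (by gcongr)
  have h4 : 0 < 8 * n / θ := by positivity
  have h5 : 0 < (T : ℝ) := lt_of_lt_of_le (mul_pos h4 (h2.trans_le h3)) hT
  have h6 : Real.log (n / δ) ≤ θ / n * T / 8 := by
    have : θ / n * T / 8 = T / (8 * n / θ) := by field_simp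
    rw [this, le_div_iff₀ h4, mul_comm]
    exact hT
  refine ⟨h5, h6, h3.trans (h6.trans ?_)⟩
  have h7 : θ / n ≤ θ := div_le_self h0.le hn'
  have h8 : θ / n * T ≤ θ * T := by gcongr
  have : 0 < θ * T := by positivity
  linarith

open scoped Classical in
theorem sum_goodRows_ge (hn : 0 < n) (h0 : 0 < θ) (h1 : θ ≤ 1) (hδ : 0 < δ)
    (hδ1 : δ < Real.exp (-1)) (hT : 8 * n / θ * Real.log (n / δ) ≤ T) :
    1 - 2 * δ ≤ ∑ o : Fin T → Option (Fin n) with GoodRows θ o, ∏ t, rowWeight n θ (o t) := by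
  have hn' : (0 : ℝ) < n := by exact_mod_cast hn
  obtain ⟨hT0, hlog1, hlog2⟩ := log_bounds hn h0 hδ hδ1 hT
  have hw : ∀ o : Fin T → Option (Fin n), 0 ≤ ∏ t, rowWeight n θ (o t) := fun o =>
    Finset.prod_nonneg fun t _ => rowWeight_nonneg h0 h1 _
  have hlow : ∀ i : Fin n, ∑ o : Fin T → Option (Fin n) with
      ((obs o i).card : ℝ) < θ / n * T / 2, ∏ t, rowWeight n θ (o t) ≤ δ / n := by
    intro i
    refine (sum_filter_card_obs_lt_le h0 h1 i).trans ?_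
    rw [← Real.le_log_iff_exp_le (by positivity), ← inv_div (n : ℝ) δ, Real.log_inv]
    linarith
  have hup : ∑ o : Fin T → Option (Fin n) with 4 * θ * T < ∑ i, ((obs o i).card : ℝ),
      ∏ t, rowWeight n θ (o t) ≤ δ := by
    refine (sum_filter_lt_sum_card_obs_le hn h0 h1).trans ?_
    rw [one_div, Real.log_inv] at hlog2
    rw [← Real.le_log_iff_exp_le hδ]
    linarith
  have hone := sum_prod_rowWeight (T := T) (θ := θ) hn
  -- The union bound, stated patternwise before summation.
  have hkey : ∀ o : Fin T → Option (Fin n), ∏ t, rowWeight n θ (o t) ≤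
      (if GoodRows θ o then ∏ t, rowWeight n θ (o t) else 0) +
        ((∑ i, if ((obs o i).card : ℝ) < θ / n * T / 2 then ∏ t, rowWeight n θ (o t) else 0) +
        if 4 * θ * T < ∑ i, ((obs o i).card : ℝ) then ∏ t, rowWeight n θ (o t) else 0) := by
    intro o
    have hs : ∀ i, 0 ≤ if ((obs o i).card : ℝ) < θ / n * T / 2 then
        ∏ t, rowWeight n θ (o t) else 0 := fun i => by split_ifs <;> simp [hw o]
    have hs' := Finset.sum_nonneg fun i (_ : i ∈ Finset.univ) => hs i
    by_cases hg : GoodRows θ o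
    · rw [if_pos hg]
      have : 0 ≤ if 4 * θ * T < ∑ i, ((obs o i).card : ℝ) then ∏ t, rowWeight n θ (o t) else 0 := by
        split_ifs <;> simp [hw o]
      linarith
    · rw [if_neg hg, zero_add]
      simp only [GoodRows, not_and_or, not_forall, not_le] at hg
      rcases hg with ⟨i, hi⟩ | hg
      · have h2 := Finset.single_le_sum (fun i _ => hs i) (Finset.mem_univ i)
        rw [if_pos hi] at h2
        have : 0 ≤ if 4 * θ * T < ∑ i, ((obs o i).card : ℝ) then
            ∏ t, rowWeight n θ (o t) else 0 := by
          split_ifs <;> simp [hw o]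
        linarith
      · rw [if_pos hg]
        linarith
  have hsum := Finset.sum_le_sum fun o (_ : o ∈ Finset.univ) => hkey o
  rw [hone, Finset.sum_add_distrib, Finset.sum_add_distrib,
    Finset.sum_comm (t := (Finset.univ : Finset (Fin n)))] at hsum
  simp only [← Finset.sum_filter] at hsum
  have h3 : ∑ _i : Fin n, δ / n = δ := by
    simp [mul_div_cancel₀ _ hn'.ne']
  have h4 := Finset.sum_le_sum fun i (_ : i ∈ Finset.univ) => hlow i
  rw [h3] at h4
  linarith

/-- With probability at least `1 - 3 δ` both the row pattern and the noise are good. -/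
theorem SparseModel.exists_good_event {C : Fin T → Ω → Fin n → ℝ}
    {η : Ω → EuclideanSpace ℝ (Fin T)} (h : SparseModel P θ σ C η) (hn : 0 < n) (h0 : 0 < θ)
    (h1 : θ ≤ 1) (hσ : 0 ≤ σ) (hδ : 0 < δ) (hδ1 : δ < Real.exp (-1))
    (hT : 8 * n / θ * Real.log (n / δ) ≤ T) :
    ∃ E : Set Ω, MeasurableSet E ∧ 1 - 3 * δ ≤ P.real E ∧ ∀ ω ∈ E,
      ∃ o : Fin T → Option (Fin n), (fun t => C t ω) = (fun t => rowVec (o t)) ∧ GoodRows θ o ∧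
        η ω ∈ goodNoise o (12 * σ ^ 2 * Real.log (1 / δ)) := by
  classical
  set R := 12 * σ ^ 2 * Real.log (1 / δ) with hR
  have hn' : (0 : ℝ) < n := by exact_mod_cast hn
  obtain ⟨hT0, -, -⟩ := log_bounds hn h0 hδ hδ1 hT
  let B : (Fin T → Option (Fin n)) → Set Ω := fun o =>
    (fun ω t => C t ω) ⁻¹' {fun t => rowVec (o t)}
  have hCm : Measurable fun ω t => C t ω := measurable_pi_lambda _ h.measurable_row
  have hBm : ∀ o, MeasurableSet (B o) := fun o => hCm (measurableSet_singleton _)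
  have hAm : ∀ o : Fin T → Option (Fin n), MeasurableSet (η ⁻¹' goodNoise o R) := fun o =>
    h.measurable_noise (measurableSet_goodNoise o R)
  -- Slicing by the finitely many patterns replaces conditioning: on each slice the noise set is
  -- fixed, so independence multiplies the probabilities, and the slices are disjoint.
  refine ⟨⋃ o ∈ Finset.univ.filter (GoodRows θ), B o ∩ η ⁻¹' goodNoise o R, ?_, ?_, ?_⟩
  · exact Finset.measurableSet_biUnion _ fun o _ => (hBm o).inter (hAm o)
  · rw [measureReal_biUnion_finset]
    · have hδ' : δ < 1 := hδ1.trans (Real.exp_lt_one_iff.mpr (by norm_num))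
      have h2 : ∀ o ∈ Finset.univ.filter (GoodRows θ),
          (∏ t, rowWeight n θ (o t)) * (1 - δ) ≤ P.real (B o ∩ η ⁻¹' goodNoise o R) := by
        intro o ho
        have hg := (Finset.mem_filter.mp ho).2
        have hne : ∀ i, (obs o i).Nonempty := fun i => by
          have : 0 < θ / n * T / 2 := by positivity
          have h3 := this.trans_le (hg.1 i)
          exact Finset.card_pos.mp (by exact_mod_cast h3)
        have h3 := (indepFun_iff_measure_inter_preimage_eq_mul.mp h.indep_noise)
          {fun t => rowVec (o t)} (goodNoise o R) (measurableSet_singleton _)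
          (measurableSet_goodNoise o R)
        rw [measureReal_def, h3, ENNReal.toReal_mul, ← measureReal_def, ← measureReal_def,
          h.measureReal_rows_eq hn h0 h1]
        gcongr
        · exact Finset.prod_nonneg fun t _ => rowWeight_nonneg h0 h1 _
        · exact h.subgaussian_noise.measureReal_goodNoise_ge hn hσ hδ hδ1 h.measurable_noise hne
      refine le_trans ?_ (Finset.sum_le_sum h2)
      rw [← Finset.sum_mul]
      have h4 := sum_goodRows_ge hn h0 h1 hδ hδ1 hT
      calc 1 - 3 * δ ≤ (1 - 2 * δ) * (1 - δ) := by nlinarith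
        _ ≤ _ := by gcongr
    · intro o _ o' _ hne
      refine Disjoint.mono Set.inter_subset_left Set.inter_subset_left ?_
      refine Disjoint.preimage _ (Set.disjoint_singleton.mpr fun heq => hne ?_)
      funext t
      exact rowVec_injective (congrFun heq t)
    · exact fun o _ => (hBm o).inter (hAm o)
  · intro ω hω
    simp only [Set.mem_iUnion, Finset.mem_filter, Finset.mem_univ, true_and] at hω
    obtain ⟨o, hg, hB, hA⟩ := hω
    exact ⟨o, hB, hg, hA⟩

end GoodEvent

/-! ### Error bounds and consistency for graphs with a spectral gap -/

section Main

/-- The error bound for a graph on `T` nodes whose roughness level divided by the spectral gap is `s`. -/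
noncomputable def errorBound (n T : ℕ) (θ σ s δ : ℝ) : ℝ :=
  1536 * (n * s / θ + (n * σ ^ (2 / 3 : ℝ) * (T : ℝ) ^ (1 / 3 : ℝ) * s ^ (2 / 3 : ℝ) /
    θ ^ (2 / 3 : ℝ) + (n : ℝ) ^ 3 * σ ^ 2 / θ ^ 2) * Real.log (1 / δ))

theorem rpow_two_thirds {a : ℝ} (ha : 0 ≤ a) : a ^ (2 / 3 : ℝ) = (a ^ (1 / 3 : ℝ)) ^ 2 := by
  rw [← Real.rpow_natCast, ← Real.rpow_mul ha]
  norm_num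

theorem rpow_third_pow {a : ℝ} (ha : 0 ≤ a) : (a ^ (1 / 3 : ℝ)) ^ 3 = a := by
  rw [← Real.rpow_natCast, ← Real.rpow_mul ha]
  norm_num

/-- The choice of the penalty balances the noise term against the roughness. -/
theorem noise_term_le {T θ σ s b : ℝ} (hT : 0 < T) (hθ : 0 < θ) (hσ : 0 ≤ σ) (hs : 0 < s)
    (hb : 0 < b) (h : σ ^ (2 / 3 : ℝ) * (θ * T / s) ^ (1 / 3 : ℝ) ≤ b) :
    T * σ ^ 2 / b ^ 2 ≤
      σ ^ (2 / 3 : ℝ) * T ^ (1 / 3 : ℝ) * s ^ (2 / 3 : ℝ) / θ ^ (2 / 3 : ℝ) := by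
  rw [Real.div_rpow (by positivity) hs.le, Real.mul_rpow hθ.le hT.le] at h
  rw [rpow_two_thirds hs.le, rpow_two_thirds hθ.le]
  have hσ' : σ ^ 2 = (σ ^ (2 / 3 : ℝ)) ^ 3 := by
    rw [rpow_two_thirds hσ, ← pow_mul, mul_comm, pow_mul, rpow_third_pow hσ]
  have hT' := rpow_third_pow hT.le
  have hA : 0 ≤ σ ^ (2 / 3 : ℝ) := Real.rpow_nonneg hσ _
  have hτ : 0 < T ^ (1 / 3 : ℝ) := Real.rpow_pos_of_pos hT _
  have ht : 0 < θ ^ (1 / 3 : ℝ) := Real.rpow_pos_of_pos hθ _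
  have hr : 0 < s ^ (1 / 3 : ℝ) := Real.rpow_pos_of_pos hs _
  rw [hσ']
  -- In the cube roots the claim is rational, and the hypothesis reads `A * (t * τ / r) ≤ b`.
  generalize σ ^ (2 / 3 : ℝ) = A at *
  generalize T ^ (1 / 3 : ℝ) = τ at *
  generalize θ ^ (1 / 3 : ℝ) = t at *
  generalize s ^ (1 / 3 : ℝ) = r at *
  subst hT'
  rw [div_le_iff₀ (by positivity)]
  calc τ ^ 3 * A ^ 3 = A * τ * r ^ 2 / t ^ 2 * (A * (t * τ / r)) ^ 2 := by field_simp
    _ ≤ A * τ * r ^ 2 / t ^ 2 * b ^ 2 := by gcongr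

variable {T n : ℕ} {θ σ δ S lam μ : ℝ} {G : SimpleGraph (Fin T)} {Ω : Type*} [MeasurableSpace Ω]
  {P : Measure Ω} [IsProbabilityMeasure P]

/-- The deterministic error bound for good rows and good noise. -/
theorem norm_sq_le_errorBound (hn : 0 < n) (hT : 0 < (T : ℝ)) (h0 : 0 < θ) (h1 : θ ≤ 1)
    (hσ : 0 ≤ σ) (hS : 0 < S) (hL : 0 ≤ Real.log (1 / δ)) (hlam : 0 < lam) (hμ : 1 ≤ μ * lam)
    (hμσ : σ ^ (2 / 3 : ℝ) * (θ * T / (S / lam)) ^ (1 / 3 : ℝ) ≤ 1 + μ * lam)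
    (hgap : ∀ f : Fin T → ℝ, lam * ∑ t, (f t - (∑ s, f s) / T) ^ 2 ≤ dirichlet G f f)
    {o : Fin T → Option (Fin n)} {x xhat : EuclideanSpace ℝ (Fin T × Fin n)}
    {η : EuclideanSpace ℝ (Fin T)} (hx : roughness G x ≤ S) (hg : GoodRows θ o)
    (hη : η ∈ goodNoise o (12 * σ ^ 2 * Real.log (1 / δ)))
    (h : IsEstimate G μ (fun t => rowVec (o t)) (observe (fun t => rowVec (o t)) x η) xhat) :
    ‖xhat - x‖ ^ 2 ≤ errorBound n T θ σ (S / lam) δ := by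
  have hn1 : (1 : ℝ) ≤ n := by exact_mod_cast hn
  have hn' : (0 : ℝ) < n := by linarith
  have hne : ∀ i, (obs o i).Nonempty := fun i => by
    have : 0 < θ / n * T / 2 := by positivity
    have h3 := this.trans_le (hg.1 i)
    exact Finset.card_pos.mp (by exact_mod_cast h3)
  have hr : ∀ i, (T : ℝ) ≤ 2 * n / θ * (obs o i).card := fun i => by
    calc (T : ℝ) = 2 * n / θ * (θ / n * T / 2) := by field_simp
      _ ≤ _ := by gcongr; exact hg.1 i
  have hb := h.norm_sq_le hne hr (by positivity) hlam hμ hgap hx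
  set L := Real.log (1 / δ) with hLdef
  have hH : ∑ i, ∑ t ∈ obs o i, η t ^ 2 ≤ 4 * θ * T * (12 * σ ^ 2 * L) :=
    hη.1.trans (by gcongr; exact hg.2)
  have hnoise := noise_term_le hT h0 hσ (div_pos hS hlam) (b := 1 + μ * lam) (by linarith) hμσ
  -- The mean-noise term comes out as `n ^ 2 / θ`; it is relaxed to the stated form by `θ ≤ 1 ≤ n`.
  have hnθ : (n : ℝ) ^ 2 / θ ≤ (n : ℝ) ^ 3 / θ ^ 2 := by
    rw [div_le_div_iff₀ h0 (by positivity)]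
    calc (n : ℝ) ^ 2 * θ ^ 2 = n ^ 2 * θ * θ := by ring
      _ ≤ n ^ 2 * θ * n := by gcongr; linarith
      _ = n ^ 3 * θ := by ring
  set X := σ ^ (2 / 3 : ℝ) * (T : ℝ) ^ (1 / 3 : ℝ) * (S / lam) ^ (2 / 3 : ℝ) / θ ^ (2 / 3 : ℝ) with hX
  have hX0 : 0 ≤ X := le_trans (by positivity) hnoise
  have hbound : errorBound n T θ σ (S / lam) δ =
      1536 * (n * (S / lam) / θ + (n * X + n ^ 3 / θ ^ 2 * σ ^ 2) * L) := by
    rw [errorBound, hX]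
    ring
  rw [hbound]
  have h2 : 0 < 1 + μ * lam := by linarith
  -- Here `r = 2 * n / θ`. The constant `1536 = 8 * 4 * 48` comes from the noise energy; the other
  -- two terms need only 16 and 48.
  calc ‖xhat - x‖ ^ 2 ≤ 4 * (2 * n / θ) * (4 * (4 * θ * T * (12 * σ ^ 2 * L)) / (1 + μ * lam) ^ 2 +
        2 * S / lam) + 2 * (2 * n / θ) * (n * (12 * σ ^ 2 * L)) := by
        refine hb.trans ?_
        gcongr
        exact hη.2
    _ = 16 * (n * (S / lam) / θ) + 1536 * (n * (T * σ ^ 2 / (1 + μ * lam) ^ 2) * L) +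
        48 * (n ^ 2 / θ * σ ^ 2 * L) := by
        field_simp
        ring
    _ ≤ 1536 * (n * (S / lam) / θ) + 1536 * (n * X * L) + 1536 * (n ^ 3 / θ ^ 2 * σ ^ 2 * L) := by
        gcongr <;> norm_num
    _ = _ := by ring

/-- The error bound, with high probability, for a graph with spectral gap `lam`. -/
theorem SparseModel.exists_errorBound_event {C : Fin T → Ω → Fin n → ℝ}
    {η : Ω → EuclideanSpace ℝ (Fin T)} (h : SparseModel P θ σ C η) (hn : 0 < n) (h0 : 0 < θ)
    (h1 : θ ≤ 1) (hσ : 0 ≤ σ) (hS : 0 < S) (hδ : 0 < δ) (hδ1 : δ < Real.exp (-1))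
    (hT : 8 * n / θ * Real.log (n / δ) ≤ T) (hlam : 0 < lam) (hμ : 1 ≤ μ * lam)
    (hμσ : σ ^ (2 / 3 : ℝ) * (θ * T / (S / lam)) ^ (1 / 3 : ℝ) ≤ 1 + μ * lam)
    (hgap : ∀ f : Fin T → ℝ, lam * ∑ t, (f t - (∑ s, f s) / T) ^ 2 ≤ dirichlet G f f)
    {x : EuclideanSpace ℝ (Fin T × Fin n)} (hx : roughness G x ≤ S) :
    ∃ E : Set Ω, MeasurableSet E ∧ 1 - 3 * δ ≤ P.real E ∧ ∀ ω ∈ E,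
      (∃ xhat, IsEstimate G μ (fun t => C t ω) (observe (fun t => C t ω) x (η ω)) xhat) ∧
      ∀ xhat, IsEstimate G μ (fun t => C t ω) (observe (fun t => C t ω) x (η ω)) xhat →
        ‖xhat - x‖ ^ 2 ≤ errorBound n T θ σ (S / lam) δ := by
  obtain ⟨E, hE, hPE, hgood⟩ := h.exists_good_event hn h0 h1 hσ hδ hδ1 hT
  obtain ⟨hT0, -, -⟩ := log_bounds hn h0 hδ hδ1 hT
  have hμ0 : 0 ≤ μ := by
    by_contra hneg
    nlinarith
  have hL : 0 ≤ Real.log (1 / δ) := by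
    have : δ < 1 := hδ1.trans (Real.exp_lt_one_iff.mpr (by norm_num))
    exact Real.log_nonneg (by rw [le_div_iff₀ hδ]; linarith)
  refine ⟨E, hE, hPE, fun ω hω => ⟨exists_isEstimate hμ0 _ _, fun xhat hxhat => ?_⟩⟩
  obtain ⟨o, ho, hg, hη⟩ := hgood ω hω
  rw [ho] at hxhat
  exact norm_sq_le_errorBound hn hT0 h0 h1 hσ hS hL hlam hμ hμσ hgap hx hg hη hxhat

/-- An event of probability at least `1 - ε` bounds the outer measure of a bad set. -/
theorem measure_le_of_event {E B : Set Ω} {ε : ℝ} (hE : MeasurableSet E)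
    (hP : 1 - ε ≤ P.real E) (hB : ∀ ω ∈ E, ω ∉ B) : P B ≤ ENNReal.ofReal ε := by
  have h1 : B ⊆ Eᶜ := fun ω hω hE => hB ω hE hω
  refine (measure_mono h1).trans ?_
  rw [← ofReal_measureReal]
  refine ENNReal.ofReal_le_ofReal ?_
  rw [probReal_compl_eq_one_sub hE]
  linarith

/-- With `u = s / (T θ)` and `v = 1 / (√T θ)`, the three terms of the quotient are multiples of `u`,
`u ^ (2/3)` and `v ^ 2`; the two entries of the maximum send `u` and `v` to zero. -/
theorem tendsto_errorBound_div (n : ℕ) (σ δ : ℝ) {θ s : ℕ → ℝ} (hθ0 : ∀ T, 0 < θ T)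
    (hs : ∀ T, 0 ≤ s T)
    (hθ : (fun T : ℕ => max (1 / √(T : ℝ)) (s T / T)) =o[atTop] θ) :
    Tendsto (fun T : ℕ => errorBound n T (θ T) σ (s T) δ / T) atTop (𝓝 0) := by
  have hu : Tendsto (fun T : ℕ => s T / T / θ T) atTop (𝓝 0) := by
    refine Asymptotics.IsLittleO.tendsto_div_nhds_zero ?_
    refine (Asymptotics.IsBigO.of_norm_le fun T => ?_).trans_isLittleO hθ
    have : 0 ≤ s T / T := div_nonneg (hs T) (Nat.cast_nonneg T)
    rw [Real.norm_eq_abs, abs_of_nonneg this]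
    exact le_max_right _ _
  have hv : Tendsto (fun T : ℕ => 1 / √(T : ℝ) / θ T) atTop (𝓝 0) := by
    refine Asymptotics.IsLittleO.tendsto_div_nhds_zero ?_
    refine (Asymptotics.IsBigO.of_norm_le fun T => ?_).trans_isLittleO hθ
    rw [Real.norm_eq_abs, abs_of_nonneg (by positivity)]
    exact le_max_left _ _
  have hu' := hu.rpow_const (p := 2 / 3) (Or.inr (by norm_num))
  rw [Real.zero_rpow (by norm_num)] at hu'
  have hlim := ((hu.const_mul (n : ℝ)).add (((hu'.const_mul (n * σ ^ (2 / 3 : ℝ))).add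
    ((hv.pow 2).const_mul ((n : ℝ) ^ 3 * σ ^ 2))).mul_const (Real.log (1 / δ)))).const_mul 1536
  simp only [mul_zero, zero_pow, ne_eq, OfNat.ofNat_ne_zero, not_false_eq_true, add_zero,
    zero_mul] at hlim
  refine hlim.congr' ?_
  filter_upwards [eventually_gt_atTop 0] with T hT
  have hT' : (0 : ℝ) < T := by exact_mod_cast hT
  have h1 : (s T / T / θ T) ^ (2 / 3 : ℝ) =
      (T : ℝ) ^ (1 / 3 : ℝ) * s T ^ (2 / 3 : ℝ) / θ T ^ (2 / 3 : ℝ) / T := by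
    have hdiv : 0 ≤ s T / T := div_nonneg (hs T) hT'.le
    rw [Real.div_rpow hdiv (hθ0 T).le, Real.div_rpow (hs T) hT'.le, rpow_two_thirds hT'.le]
    have h3 := rpow_third_pow hT'.le
    have hτ : 0 < (T : ℝ) ^ (1 / 3 : ℝ) := Real.rpow_pos_of_pos hT' _
    have ht : 0 < θ T ^ (2 / 3 : ℝ) := Real.rpow_pos_of_pos (hθ0 T) _
    generalize (T : ℝ) ^ (1 / 3 : ℝ) = τ at *
    rw [← h3]
    field_simp
  have h2 : (1 / √(T : ℝ) / θ T) ^ 2 = 1 / θ T ^ 2 / T := by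
    rw [div_pow, div_pow, Real.sq_sqrt hT'.le, one_pow, div_right_comm]
  rw [h1, h2, errorBound]
  have := hθ0 T
  ring

/-- The growth of `θ` against `1 / √T` makes any constant over `θ` eventually at most `√T`, hence at
most `T`. -/
theorem eventually_sample_size (n : ℕ) (δ : ℝ) {θ s : ℕ → ℝ} (hθ0 : ∀ T, 0 < θ T)
    (hθ : (fun T : ℕ => max (1 / √(T : ℝ)) (s T / T)) =o[atTop] θ) :
    ∀ᶠ T : ℕ in atTop, 8 * n / θ T * Real.log (n / δ) ≤ T := by
  set c := 8 * n * |Real.log (n / δ)| + 1 with hc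
  have hc0 : 0 < c := by positivity
  filter_upwards [hθ.def (inv_pos.mpr hc0), eventually_gt_atTop 0] with T hT hT1
  have hT' : (1 : ℝ) ≤ T := by exact_mod_cast hT1
  have hsq : (1 : ℝ) ≤ √T := by rw [Real.one_le_sqrt]; exact hT'
  rw [Real.norm_eq_abs, Real.norm_eq_abs, abs_of_pos (hθ0 T)] at hT
  have h1 : 1 / √(T : ℝ) ≤ c⁻¹ * θ T := (le_max_left _ _).trans ((le_abs_self _).trans hT)
  have hθT := hθ0 T
  have h2 : c / θ T ≤ √T := by
    rw [div_le_iff₀ hθT]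
    rw [div_le_iff₀ (by positivity), ← div_eq_inv_mul, div_mul_eq_mul_div, le_div_iff₀ hc0] at h1
    linarith
  calc 8 * n / θ T * Real.log (n / δ) ≤ 8 * n / θ T * |Real.log (n / δ)| := by
        gcongr
        exact le_abs_self _
    _ = (8 * n * |Real.log (n / δ)|) / θ T := by ring
    _ ≤ c / θ T := by gcongr; linarith
    _ ≤ √T := h2
    _ ≤ √T * √T := le_mul_of_one_le_left (by positivity) hsq
    _ = T := Real.mul_self_sqrt (by positivity)

/-- Error bounds for every confidence level imply consistency. Here `p T b` is the probability that the
squared error of the estimate on `T` nodes exceeds `b`. -/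
theorem tendsto_zero_of_errorBound {n : ℕ} {σ : ℝ} {θ s : ℕ → ℝ} (hθ0 : ∀ T, 0 < θ T)
    (hs : ∀ T, 0 ≤ s T) (hθ : (fun T : ℕ => max (1 / √(T : ℝ)) (s T / T)) =o[atTop] θ)
    {p : ℕ → ℝ → ℝ≥0∞} (hp : ∀ T, Antitone (p T))
    (hbound : ∀ T δ, 0 < δ → δ < Real.exp (-1) → 8 * n / θ T * Real.log (n / δ) ≤ T →
      p T (errorBound n T (θ T) σ (s T) δ) ≤ ENNReal.ofReal (3 * δ)) {ε : ℝ} (hε : 0 < ε) :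
    Tendsto (fun T : ℕ => p T (ε * T)) atTop (𝓝 0) := by
  rw [ENNReal.tendsto_nhds_zero]
  intro e he
  -- Truncation at 1 keeps the tolerance finite, so a real `δ` can be chosen below it.
  have hm0 : min e 1 ≠ 0 := (lt_min he one_pos).ne'
  have hmt : min e 1 ≠ ∞ := ne_top_of_le_ne_top ENNReal.one_ne_top (min_le_right _ _)
  have hm : 0 < (min e 1).toReal := ENNReal.toReal_pos hm0 hmt
  have hexp := Real.exp_pos (-1)
  obtain ⟨δ, hδ, hδ1, hδe⟩ : ∃ δ : ℝ, 0 < δ ∧ δ < Real.exp (-1) ∧ 3 * δ ≤ (min e 1).toReal := by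
    refine ⟨min (Real.exp (-1) / 2) ((min e 1).toReal / 3), by positivity, ?_, ?_⟩
    · exact (min_le_left _ _).trans_lt (half_lt_self hexp)
    · linarith [min_le_right (Real.exp (-1) / 2) ((min e 1).toReal / 3)]
  filter_upwards [eventually_sample_size n δ hθ0 hθ, eventually_gt_atTop 0,
    (tendsto_errorBound_div n σ δ hθ0 hs hθ).eventually_le_const hε] with T hT hT0 hb
  have hT' : (0 : ℝ) < T := by exact_mod_cast hT0
  rw [div_le_iff₀ hT'] at hb
  calc p T (ε * T) ≤ p T (errorBound n T (θ T) σ (s T) δ) := hp T hb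
    _ ≤ ENNReal.ofReal (3 * δ) := hbound T δ hδ hδ1 hT
    _ ≤ ENNReal.ofReal (min e 1).toReal := ENNReal.ofReal_le_ofReal hδe
    _ = min e 1 := ENNReal.ofReal_toReal hmt
    _ ≤ e := min_le_left _ _

end Main

/-! ### The complete graph and the star graph -/

section Graphs

variable {T n : ℕ} {θ σ S : ℝ}

theorem one_le_muComplete_mul (hT : 0 < (T : ℝ)) : 1 ≤ muComplete 1 n T θ σ S * T := by
  rw [← div_le_iff₀ hT]
  exact le_max_right _ _

/-- Multiplied by the gap `T`, the subtracted `θ / (T * n)` costs `θ / n ≤ 1`, which the summand 1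
on the right repays. -/
theorem le_one_add_muComplete_mul (hn : 0 < n) (hT : 0 < (T : ℝ)) (h0 : 0 < θ) (h1 : θ ≤ 1)
    (hS : 0 < S) :
    σ ^ (2 / 3 : ℝ) * (θ * T / (S / T)) ^ (1 / 3 : ℝ) ≤ 1 + muComplete 1 n T θ σ S * T := by
  have hn' : (1 : ℝ) ≤ n := by exact_mod_cast hn
  have h2 : (θ * T / (S / T)) ^ (1 / 3 : ℝ) = T * (θ / (T * S)) ^ (1 / 3 : ℝ) := by
    have h3 : θ * T / (S / T) = (T : ℝ) ^ 3 * (θ / (T * S)) := by field_simp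
    rw [h3, Real.mul_rpow (by positivity) (by positivity), ← Real.rpow_natCast,
      ← Real.rpow_mul hT.le]
    norm_num
  have h4 : σ ^ (2 / 3 : ℝ) * (θ / (T * S)) ^ (1 / 3 : ℝ) - θ / (T * n) ≤
      muComplete 1 n T θ σ S := le_max_left _ _
  have h5 : θ / n ≤ 1 := (div_le_self h0.le hn').trans h1
  have h6 : θ / (T * n) * T = θ / n := by field_simp
  have h7 := mul_le_mul_of_nonneg_right h4 hT.le
  rw [sub_mul, h6] at h7
  rw [h2]
  linarith

theorem one_le_muStar : 1 ≤ muStar 1 n T θ σ S := le_max_right _ _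

theorem le_one_add_muStar (hn : 0 < n) (h0 : 0 < θ) (h1 : θ ≤ 1) (hS : 0 < S) :
    σ ^ (2 / 3 : ℝ) * (θ * T / S) ^ (1 / 3 : ℝ) ≤ 1 + muStar 1 n T θ σ S := by
  have hn' : (1 : ℝ) ≤ n := by exact_mod_cast hn
  have h4 : σ ^ (2 / 3 : ℝ) * θ ^ (1 / 3 : ℝ) * (T : ℝ) ^ (1 / 3 : ℝ) / S ^ (1 / 3 : ℝ) - θ / n ≤
      muStar 1 n T θ σ S := le_max_left _ _
  have h5 : θ / n ≤ 1 := (div_le_self h0.le hn').trans h1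
  rw [Real.div_rpow (by positivity) hS.le, Real.mul_rpow h0.le (by positivity), ← mul_div_assoc,
    ← mul_assoc]
  linarith

theorem errorBound_complete (hT : 0 < (T : ℝ)) (hS : 0 < S) (δ : ℝ) :
    errorBound n T θ σ (S / T) δ = 1536 * (n * S / (θ * T) +
      (n * σ ^ (2 / 3 : ℝ) * S ^ (2 / 3 : ℝ) / (θ ^ (2 / 3 : ℝ) * (T : ℝ) ^ (1 / 3 : ℝ)) +
        (n : ℝ) ^ 3 * σ ^ 2 / θ ^ 2) * Real.log (1 / δ)) := by
  have h1 : (T : ℝ) ^ (1 / 3 : ℝ) * (S / T) ^ (2 / 3 : ℝ) =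
      S ^ (2 / 3 : ℝ) / (T : ℝ) ^ (1 / 3 : ℝ) := by
    have hτ : 0 < (T : ℝ) ^ (1 / 3 : ℝ) := Real.rpow_pos_of_pos hT _
    rw [Real.div_rpow hS.le hT.le, rpow_two_thirds hT.le]
    field_simp
  rw [errorBound, mul_assoc _ ((T : ℝ) ^ (1 / 3 : ℝ)), h1, ← mul_div_assoc, ← mul_div_assoc,
    div_div, div_div, mul_comm (T : ℝ) θ, mul_comm ((T : ℝ) ^ (1 / 3 : ℝ))]

variable {Ω : Type*} [MeasurableSpace Ω] {P : Measure Ω} [IsProbabilityMeasure P] {δ : ℝ}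
  {x : EuclideanSpace ℝ (Fin T × Fin n)} {C : Fin T → Ω → Fin n → ℝ}
  {η : Ω → EuclideanSpace ℝ (Fin T)}

theorem SparseModel.exists_event_complete (h : SparseModel P θ σ C η) (hn : 0 < n) (h0 : 0 < θ)
    (h1 : θ ≤ 1) (hσ : 0 ≤ σ) (hS : 0 < S) (hδ : 0 < δ) (hδ1 : δ < Real.exp (-1))
    (hT : 8 * n / θ * Real.log (n / δ) ≤ T)
    (hx : roughness (⊤ : SimpleGraph (Fin T)) x ≤ S) :
    ∃ E : Set Ω, MeasurableSet E ∧ 1 - 3 * δ ≤ P.real E ∧ ∀ ω ∈ E,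
      (∃ xhat, IsEstimate ⊤ (muComplete 1 n T θ σ S) (fun t => C t ω)
        (observe (fun t => C t ω) x (η ω)) xhat) ∧
      ∀ xhat, IsEstimate ⊤ (muComplete 1 n T θ σ S) (fun t => C t ω)
          (observe (fun t => C t ω) x (η ω)) xhat →
        ‖xhat - x‖ ^ 2 ≤ errorBound n T θ σ (S / T) δ := by
  obtain ⟨hT0, -, -⟩ := log_bounds hn h0 hδ hδ1 hT
  exact h.exists_errorBound_event hn h0 h1 hσ hS hδ hδ1 hT hT0 (one_le_muComplete_mul hT0)
    (le_one_add_muComplete_mul hn hT0 h0 h1 hS)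
    (gap_complete (by rintro rfl; simp at hT0)) hx

theorem SparseModel.exists_event_star (h : SparseModel P θ σ C η) (hn : 0 < n) (h0 : 0 < θ)
    (h1 : θ ≤ 1) (hσ : 0 ≤ σ) (hS : 0 < S) (hδ : 0 < δ) (hδ1 : δ < Real.exp (-1))
    (hT : 8 * n / θ * Real.log (n / δ) ≤ T) {r : Fin T}
    (hx : roughness (SimpleGraph.starGraph r) x ≤ S) :
    ∃ E : Set Ω, MeasurableSet E ∧ 1 - 3 * δ ≤ P.real E ∧ ∀ ω ∈ E,
      (∃ xhat, IsEstimate (SimpleGraph.starGraph r) (muStar 1 n T θ σ S) (fun t => C t ω)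
        (observe (fun t => C t ω) x (η ω)) xhat) ∧
      ∀ xhat, IsEstimate (SimpleGraph.starGraph r) (muStar 1 n T θ σ S) (fun t => C t ω)
          (observe (fun t => C t ω) x (η ω)) xhat →
        ‖xhat - x‖ ^ 2 ≤ errorBound n T θ σ S δ := by
  obtain ⟨hT0, -, -⟩ := log_bounds hn h0 hδ hδ1 hT
  have h2 := h.exists_errorBound_event (lam := 1) (μ := muStar 1 n T θ σ S) hn h0 h1 hσ hS hδ hδ1
    hT one_pos (by rw [mul_one]; exact one_le_muStar)
    (by rw [mul_one, div_one]; exact le_one_add_muStar hn h0 h1 hS)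
    (gap_star (by rintro rfl; simp at hT0) r) hx
  rwa [div_one] at h2

end Graphs

end GraphLS

theorem mainTheorem4 :
    -- the complete graph
    (∃ c₁ > (0 : ℝ), ∃ c₂ > (0 : ℝ),
      -- the error bound, with probability at least `1 - 3 δ`
      (∀ (Ω : Type u) [MeasurableSpace Ω] (P : Measure Ω) [IsProbabilityMeasure P]
        (n T : ℕ) (θ σ S δ : ℝ) (x : EuclideanSpace ℝ (Fin T × Fin n))
        (C : Fin T → Ω → Fin n → ℝ) (η : Ω → EuclideanSpace ℝ (Fin T)),
        0 < n → 0 < θ → θ ≤ 1 → 0 ≤ σ → 0 < S → 0 < δ → δ < Real.exp (-1) →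
        8 * n / θ * Real.log (n / δ) ≤ T →
        GraphLS.roughness (⊤ : SimpleGraph (Fin T)) x ≤ S →
        GraphLS.SparseModel P θ σ C η →
        ∃ E : Set Ω, MeasurableSet E ∧ 1 - 3 * δ ≤ P.real E ∧ ∀ ω ∈ E,
          (∃ xhat, GraphLS.IsEstimate ⊤ (GraphLS.muComplete c₁ n T θ σ S) (fun t => C t ω)
            (GraphLS.observe (fun t => C t ω) x (η ω)) xhat) ∧
          ∀ xhat, GraphLS.IsEstimate ⊤ (GraphLS.muComplete c₁ n T θ σ S) (fun t => C t ω)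
              (GraphLS.observe (fun t => C t ω) x (η ω)) xhat →
            ‖xhat - x‖ ^ 2 ≤ c₂ * (n * S / (θ * T) +
              (n * σ ^ (2 / 3 : ℝ) * S ^ (2 / 3 : ℝ) / (θ ^ (2 / 3 : ℝ) * (T : ℝ) ^ (1 / 3 : ℝ)) +
                (n : ℝ) ^ 3 * σ ^ 2 / θ ^ 2) * Real.log (1 / δ))) ∧
      -- weak consistency for fixed `n` and `σ`
      (∀ (n : ℕ) (σ : ℝ) (θ S : ℕ → ℝ)
        (Ω : ℕ → Type u) [∀ T, MeasurableSpace (Ω T)] (P : ∀ T, Measure (Ω T))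
        [∀ T, IsProbabilityMeasure (P T)]
        (x : ∀ T, EuclideanSpace ℝ (Fin T × Fin n))
        (C : ∀ T, Fin T → Ω T → Fin n → ℝ) (η : ∀ T, Ω T → EuclideanSpace ℝ (Fin T)),
        0 < n → 0 ≤ σ → (∀ T, 0 < θ T ∧ θ T ≤ 1) → (∀ T, 0 < S T) →
        S =o[atTop] (fun T : ℕ => (T : ℝ) ^ 2) →
        (fun T : ℕ => max (1 / √(T : ℝ)) (S T / (T : ℝ) ^ 2)) =o[atTop] θ →
        (∀ T, GraphLS.roughness (⊤ : SimpleGraph (Fin T)) (x T) ≤ S T) →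
        (∀ T, GraphLS.SparseModel (P T) (θ T) σ (C T) (η T)) →
        ∀ ε > (0 : ℝ), Tendsto (fun T : ℕ => P T {ω | ¬ ∀ xhat,
          GraphLS.IsEstimate ⊤ (GraphLS.muComplete c₁ n T (θ T) σ (S T)) (fun t => C T t ω)
              (GraphLS.observe (fun t => C T t ω) (x T) (η T ω)) xhat →
            1 / (T : ℝ) * ‖xhat - x T‖ ^ 2 ≤ ε}) atTop (𝓝 0))) ∧
    -- the star graph
    (∃ c₁ > (0 : ℝ), ∃ c₂ > (0 : ℝ),
      -- the error bound, with probability at least `1 - 3 δ`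
      (∀ (Ω : Type u) [MeasurableSpace Ω] (P : Measure Ω) [IsProbabilityMeasure P]
        (n T : ℕ) (G : SimpleGraph (Fin T)) (θ σ S δ : ℝ)
        (x : EuclideanSpace ℝ (Fin T × Fin n))
        (C : Fin T → Ω → Fin n → ℝ) (η : Ω → EuclideanSpace ℝ (Fin T)),
        0 < n → (∃ r, G = SimpleGraph.starGraph r) →
        0 < θ → θ ≤ 1 → 0 ≤ σ → 0 < S → 0 < δ → δ < Real.exp (-1) →
        8 * n / θ * Real.log (n / δ) ≤ T →
        GraphLS.roughness G x ≤ S →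
        GraphLS.SparseModel P θ σ C η →
        ∃ E : Set Ω, MeasurableSet E ∧ 1 - 3 * δ ≤ P.real E ∧ ∀ ω ∈ E,
          (∃ xhat, GraphLS.IsEstimate G (GraphLS.muStar c₁ n T θ σ S) (fun t => C t ω)
            (GraphLS.observe (fun t => C t ω) x (η ω)) xhat) ∧
          ∀ xhat, GraphLS.IsEstimate G (GraphLS.muStar c₁ n T θ σ S) (fun t => C t ω)
              (GraphLS.observe (fun t => C t ω) x (η ω)) xhat →
            ‖xhat - x‖ ^ 2 ≤ c₂ * (n * S / θ +
              (n * σ ^ (2 / 3 : ℝ) * (T : ℝ) ^ (1 / 3 : ℝ) * S ^ (2 / 3 : ℝ) / θ ^ (2 / 3 : ℝ) +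
                (n : ℝ) ^ 3 * σ ^ 2 / θ ^ 2) * Real.log (1 / δ))) ∧
      -- weak consistency for fixed `n` and `σ`
      (∀ (n : ℕ) (σ : ℝ) (θ S : ℕ → ℝ) (G : ∀ T, SimpleGraph (Fin T))
        (Ω : ℕ → Type u) [∀ T, MeasurableSpace (Ω T)] (P : ∀ T, Measure (Ω T))
        [∀ T, IsProbabilityMeasure (P T)]
        (x : ∀ T, EuclideanSpace ℝ (Fin T × Fin n))
        (C : ∀ T, Fin T → Ω T → Fin n → ℝ) (η : ∀ T, Ω T → EuclideanSpace ℝ (Fin T)),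
        0 < n → 0 ≤ σ → (∀ T, 0 < T → ∃ r, G T = SimpleGraph.starGraph r) →
        (∀ T, 0 < θ T ∧ θ T ≤ 1) → (∀ T, 0 < S T) →
        S =o[atTop] (fun T : ℕ => (T : ℝ)) →
        (fun T : ℕ => max (1 / √(T : ℝ)) (S T / (T : ℝ))) =o[atTop] θ →
        (∀ T, GraphLS.roughness (G T) (x T) ≤ S T) →
        (∀ T, GraphLS.SparseModel (P T) (θ T) σ (C T) (η T)) →
        ∀ ε > (0 : ℝ), Tendsto (fun T : ℕ => P T {ω | ¬ ∀ xhat,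
          GraphLS.IsEstimate (G T) (GraphLS.muStar c₁ n T (θ T) σ (S T)) (fun t => C T t ω)
              (GraphLS.observe (fun t => C T t ω) (x T) (η T ω)) xhat →
            1 / (T : ℝ) * ‖xhat - x T‖ ^ 2 ≤ ε}) atTop (𝓝 0))) := by
  -- The choice `c₁ = 1` secures `1 ≤ μ * lam` for either gap.
  refine ⟨⟨1, one_pos, 1536, by norm_num, ?_, ?_⟩, ⟨1, one_pos, 1536, by norm_num, ?_, ?_⟩⟩
  · intro Ω _ P _ n T θ σ S δ x C η hn h0 h1 hσ hS hδ hδ1 hT hx h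
    obtain ⟨hT0, -, -⟩ := GraphLS.log_bounds hn h0 hδ hδ1 hT
    rw [← GraphLS.errorBound_complete hT0 hS]
    exact h.exists_event_complete hn h0 h1 hσ hS hδ hδ1 hT hx
  · intro n σ θ S Ω _ P _ x C η hn hσ hθ hS _ hθo hx h ε hε
    have hθo' : (fun T : ℕ => max (1 / √(T : ℝ)) (S T / T / T)) =o[atTop] θ := by
      simpa only [div_div, ← pow_two] using hθo
    have key := GraphLS.tendsto_zero_of_errorBound (σ := σ) (n := n) (s := fun T => S T / T)
      (fun T => (hθ T).1) (fun T => div_nonneg (hS T).le (Nat.cast_nonneg T)) hθo'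
      (p := fun T b => P T {ω | ¬ ∀ xhat,
          GraphLS.IsEstimate ⊤ (GraphLS.muComplete 1 n T (θ T) σ (S T)) (fun t => C T t ω)
              (GraphLS.observe (fun t => C T t ω) (x T) (η T ω)) xhat →
            ‖xhat - x T‖ ^ 2 ≤ b})
      (fun T b b' hb => measure_mono fun ω hω hcon =>
        hω fun xhat hxhat => (hcon xhat hxhat).trans hb)
      (fun T δ hδ hδ1 hT => by
        obtain ⟨E, hE, hPE, hgood⟩ := (h T).exists_event_complete hn (hθ T).1 (hθ T).2 hσ (hS T)
          hδ hδ1 hT (hx T)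
        exact GraphLS.measure_le_of_event hE hPE fun ω hω hbad => hbad (hgood ω hω).2) hε
    refine key.congr' ?_
    filter_upwards [eventually_gt_atTop 0] with T hT
    have hT' : (0 : ℝ) < T := by exact_mod_cast hT
    simp only [one_div, inv_mul_le_iff₀ hT', mul_comm]
  · intro Ω _ P _ n T G θ σ S δ x C η hn hG h0 h1 hσ hS hδ hδ1 hT hx h
    obtain ⟨r, rfl⟩ := hG
    exact h.exists_event_star hn h0 h1 hσ hS hδ hδ1 hT hx
  · intro n σ θ S G Ω _ P _ x C η hn hσ hG hθ hS _ hθo hx h ε hε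
    have key := GraphLS.tendsto_zero_of_errorBound (σ := σ) (n := n) (s := S)
      (fun T => (hθ T).1) (fun T => (hS T).le) hθo
      (p := fun T b => P T {ω | ¬ ∀ xhat,
          GraphLS.IsEstimate (G T) (GraphLS.muStar 1 n T (θ T) σ (S T)) (fun t => C T t ω)
              (GraphLS.observe (fun t => C T t ω) (x T) (η T ω)) xhat →
            ‖xhat - x T‖ ^ 2 ≤ b})
      (fun T b b' hb => measure_mono fun ω hω hcon =>
        hω fun xhat hxhat => (hcon xhat hxhat).trans hb)
      (fun T δ hδ hδ1 hT => by
        obtain ⟨hT0, -, -⟩ := GraphLS.log_bounds hn (hθ T).1 hδ hδ1 hT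
        -- A centre exists only for `T > 0`, which the sample size condition forces.
        obtain ⟨r, hr⟩ := hG T (by exact_mod_cast hT0)
        have hxT := hx T
        rw [hr] at hxT ⊢
        obtain ⟨E, hE, hPE, hgood⟩ := (h T).exists_event_star hn (hθ T).1 (hθ T).2 hσ (hS T)
          hδ hδ1 hT hxT
        exact GraphLS.measure_le_of_event hE hPE fun ω hω hbad => hbad (hgood ω hω).2) hε
    refine key.congr' ?_
    filter_upwards [eventually_gt_atTop 0] with T hT
    have hT' : (0 : ℝ) < T := by exact_mod_cast hT
    simp only [one_div, inv_mul_le_iff₀ hT', mul_comm]
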